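/- Let $\mathbb R^{2n}$ carry coordinates $(q_1,\dots,q_n,p_1,\dots,p_n)$, the $1$-form $\lambda=\sum_i p_i\,dq_i$ and the standard symplectic form $\omega=d\lambda$. Let $K\subset\mathbb R^{2n}$ be a smooth, strictly convex and centrally symmetric convex body: $K$ is compact with non-empty interior, its boundary contains no segment, $K=-K$, and $\partial K$ is a smooth hypersurface (class $C^1$ suffices). A closed characteristic on $\partial K$ is a closed $C^1$ curve $\gamma:[0,T]\to\partial K$, $T>0$, $\gamma(0)=\gamma(T)$, whose tangent vector $\dot\gamma(t)$ is nowhere zero and at each time belongs to the kernel of the restriction of $\omega$ to the tangent space $T_{\gamma(t)}\partial K$. Its action is $A(\gamma)=\int_0^T\gamma^*\lambda$. Say that $\gamma$ has minimal action if $|A(\gamma)|\le|A(\gamma')|$ for every closed characteristic $\gamma'$ on $\partial K$ (the absolute value makes the action independent of the direction in which the curve is traversed). Then every closed characteristic $\gamma$ of minimal action on $\partial K$ is itself centrally symmetric with respect to the origin: its image satisfies $-\gamma([0,T])=\gamma([0,T])$, and, moreover, $\gamma$ is an arc $\gamma_1=\gamma|_{[0,\tau]}$, $0<\tau<T$, followed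 by $-\gamma_1$, that is, there is an increasing bijection $\varphi:[0,\tau]\to[\tau,T]$ with $\gamma(\varphi(t))=-\gamma(t)$ for all $t\in[0,\tau]$. -/

import Mathlib

open Set

noncomputable section

/-- The space `ℝ²ⁿ`; the coordinates `Sum.inl i` are `qᵢ`, the coordinates `Sum.inr i` are `pᵢ`. -/
abbrev PhaseSpace (n : ℕ) : Type := EuclideanSpace ℝ (Fin n ⊕ Fin n)

/-- The standard symplectic form `ω = ∑ᵢ dpᵢ ∧ dqᵢ`, the differential of `λ = ∑ᵢ pᵢ dqᵢ`. -/
def symplecticForm {n : ℕ} (x y : PhaseSpace n) : ℝ :=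
  ∑ i : Fin n, (x (Sum.inr i) * y (Sum.inl i) - x (Sum.inl i) * y (Sum.inr i))

/-- `K` is a convex body, strictly convex, centrally symmetric (with respect to the origin) and
smooth. The origin is then an interior point of `K`, the boundary of `K` is the level set
`gauge K = 1`, and it is a hypersurface of class `C¹` exactly when the gauge function is of class
`C¹` away from the origin. Only this much smoothness is asked for. -/
structure IsSmoothStrictlyConvexSymmetricBody {n : ℕ} (K : Set (PhaseSpace n)) : Prop where
  isCompact : IsCompact K
  interior_nonempty : (interior K).Nonempty
  strictConvex : StrictConvex ℝ K
  symmetric : ∀ x ∈ K, -x ∈ K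
  smooth : ContDiffOn ℝ 1 (gauge K) {0}ᶜ

/-- The tangent space of `∂K` at the boundary point `x`: the kernel of the differential of the
gauge function, whose level set `gauge K = 1` is `∂K`. -/
def boundaryTangentSpace {n : ℕ} (K : Set (PhaseSpace n)) (x : PhaseSpace n) :
    Submodule ℝ (PhaseSpace n) :=
  LinearMap.ker (fderiv ℝ (gauge K) x : PhaseSpace n →ₗ[ℝ] ℝ)

/-- The velocity of a curve that is parametrized by `[0, T]` (one-sided at the end points). -/
def velocity {n : ℕ} (T : ℝ) (γ : ℝ → PhaseSpace n) (t : ℝ) : PhaseSpace n :=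
  derivWithin γ (Icc 0 T) t

/-- `γ : [0, T] → ∂K` is a closed characteristic: a regular closed `C¹` curve whose tangent vector
belongs, at each time, to the kernel of the restriction of `ω` to the tangent space of `∂K`.
Only the values of `γ` on `[0, T]` matter. -/
structure IsClosedCharacteristic {n : ℕ} (K : Set (PhaseSpace n)) (T : ℝ)
    (γ : ℝ → PhaseSpace n) : Prop where
  pos : 0 < T
  contDiffOn : ContDiffOn ℝ 1 γ (Icc 0 T)
  closed : γ 0 = γ T
  mem_boundary : ∀ t ∈ Icc 0 T, γ t ∈ frontier K
  velocity_ne_zero : ∀ t ∈ Icc 0 T, velocity T γ t ≠ 0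
  velocity_mem_tangent : ∀ t ∈ Icc 0 T, velocity T γ t ∈ boundaryTangentSpace K (γ t)
  velocity_mem_kernel : ∀ t ∈ Icc 0 T, ∀ v ∈ boundaryTangentSpace K (γ t),
    symplecticForm (velocity T γ t) v = 0

/-- The action `∫ γ^* λ` of a curve `γ : [0, T] → ℝ²ⁿ`, where `λ = ∑ᵢ pᵢ dqᵢ`. -/
def action {n : ℕ} (T : ℝ) (γ : ℝ → PhaseSpace n) : ℝ :=
  ∫ t in (0 : ℝ)..T, ∑ i : Fin n, γ t (Sum.inr i) * velocity T γ t (Sum.inl i)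

/-- `γ` is a closed characteristic on `∂K` of minimal action. A closed characteristic may run
along the characteristic lines in either direction, and reversing it changes the sign of its
action, so the absolute values are compared. -/
def IsMinimalClosedCharacteristic {n : ℕ} (K : Set (PhaseSpace n)) (T : ℝ)
    (γ : ℝ → PhaseSpace n) : Prop :=
  IsClosedCharacteristic K T γ ∧
    ∀ (T' : ℝ) (γ' : ℝ → PhaseSpace n), IsClosedCharacteristic K T' γ' →
      |action T γ| ≤ |action T' γ'|

/-- The closed curve `γ : [0, T] → ℝ²ⁿ` is centrally symmetric with respect to the origin as a
parametrized closed curve: it is an arc `γ₁ = γ|[0, τ]` followed by `-γ₁`, up to an increasing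
change `φ : [0, τ] → [τ, T]` of the parameter. -/
def IsCentrallySymmetricLoop {n : ℕ} (T : ℝ) (γ : ℝ → PhaseSpace n) : Prop :=
  ∃ τ ∈ Ioo 0 T, ∃ φ : ℝ → ℝ, StrictMonoOn φ (Icc 0 τ) ∧ φ '' Icc 0 τ = Icc τ T ∧
    ∀ t ∈ Icc 0 τ, γ (φ t) = -γ t

end

open Filter Topology MeasureTheory
open scoped InnerProductSpace

/-! Write `g = gauge K`, let `ω` be the symplectic form and let `X = charField K` be the Hamiltonian
field of `g`. The proof uses a dual variational principle: among loops of period `1` whose velocity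
`v` satisfies `ω(y, v) ≤ g(y)` for all `y`, maximize twice the action (`loopForm`). A closed
characteristic of action `± L/2`, run with velocity `X` and scaled by `1/L`, is such a loop of form
`1/L` (`IsClosedCharacteristic.exists_isPolarLoop`). Conversely a maximizer of form `M > 0` is, up
to translation, a characteristic on `M • ∂K` (`IsMaximalPolarLoop.exists_hasDerivAt`), and scaling
it back gives a closed characteristic of action `1/(2M)` in absolute value. Hence minimal
characteristics correspond to maximizers.

For the symmetry, cut a maximizer `z` at `z 0` and `z (1/2)` and complete each half by its
reflection in the midpoint of the chord. Because `K = -K`, both new loops are admissible; the chord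
terms cancel, so their forms average to that of `z` (`loopForm_reflectedHalf_add`) and both are
again maximizers. Each is therefore a characteristic about some centre. On the arc shared with `z`
the velocity identifies this centre with that of `z`, since strict convexity makes `X` injective on
level sets of `g`. On the reflected arc the velocity then forces the reflection centre to be the
origin, that is, `z (1/2) = -z 0` (`half_eq_neg_zero`). Any point of the loop may serve as the
starting point. Velocities are compared at single points only, so uniqueness for the characteristic
equation is never needed and class `C¹` suffices. -/

/-- The linear map `(q, p) ↦ (p, -q)`, which represents the symplectic form in terms of the
inner product. -/
noncomputable def symplecticJ (n : ℕ) : PhaseSpace n →L[ℝ] PhaseSpace n :=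
  LinearMap.toContinuousLinearMap
    { toFun := fun x => WithLp.toLp 2 (Sum.elim (fun i => x (Sum.inr i)) (fun i => -x (Sum.inl i)))
      map_add' := fun x y => by
        ext i; rcases i with i | i <;> simp [add_comm]
      map_smul' := fun a x => by
        ext i; rcases i with i | i <;> simp }

/-! ### The symplectic form expressed through the inner product. -/

section SymplecticForm

variable {n : ℕ}

@[simp] theorem symplecticJ_apply_inl (x : PhaseSpace n) (i : Fin n) :
    symplecticJ n x (Sum.inl i) = x (Sum.inr i) := rfl

@[simp] theorem symplecticJ_apply_inr (x : PhaseSpace n) (i : Fin n) :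
    symplecticJ n x (Sum.inr i) = -x (Sum.inl i) := rfl

@[simp] theorem symplecticJ_symplecticJ (x : PhaseSpace n) :
    symplecticJ n (symplecticJ n x) = -x := by
  ext i; rcases i with i | i <;> simp

theorem symplecticForm_eq_inner (x y : PhaseSpace n) :
    symplecticForm x y = ⟪symplecticJ n x, y⟫_ℝ := by
  simp only [symplecticForm, PiLp.inner_apply, Fintype.sum_sum_type, symplecticJ_apply_inl,
    symplecticJ_apply_inr, Finset.sum_sub_distrib, RCLike.inner_apply, conj_trivial]
  rw [sub_eq_add_neg, ← Finset.sum_neg_distrib]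
  congr 1 <;> exact Finset.sum_congr rfl fun i _ => by ring

theorem inner_symplecticJ_symplecticJ (x y : PhaseSpace n) :
    ⟪symplecticJ n x, symplecticJ n y⟫_ℝ = ⟪x, y⟫_ℝ := by
  simp only [PiLp.inner_apply, Fintype.sum_sum_type, symplecticJ_apply_inl,
    symplecticJ_apply_inr, RCLike.inner_apply, conj_trivial]
  rw [add_comm]
  congr 1
  exact Finset.sum_congr rfl fun i _ => by ring

theorem inner_symplecticJ_left (x y : PhaseSpace n) :
    ⟪symplecticJ n x, y⟫_ℝ = -⟪x, symplecticJ n y⟫_ℝ := by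
  rw [← inner_symplecticJ_symplecticJ x, symplecticJ_symplecticJ, ← neg_neg y]
  simp

theorem inner_symplecticJ_swap (x y : PhaseSpace n) :
    ⟪symplecticJ n x, y⟫_ℝ = -⟪symplecticJ n y, x⟫_ℝ := by
  rw [inner_symplecticJ_left, real_inner_comm]

@[simp] theorem inner_symplecticJ_self (x : PhaseSpace n) : ⟪symplecticJ n x, x⟫_ℝ = 0 := by
  have := inner_symplecticJ_swap x x
  linarith

@[simp] theorem norm_symplecticJ (x : PhaseSpace n) : ‖symplecticJ n x‖ = ‖x‖ := by
  rw [← sq_eq_sq₀ (norm_nonneg _) (norm_nonneg _), ← real_inner_self_eq_norm_sq,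
    ← real_inner_self_eq_norm_sq, inner_symplecticJ_symplecticJ]

theorem eq_of_inner_symplecticJ_eq {u v : PhaseSpace n}
    (h : ∀ y, ⟪symplecticJ n y, u⟫_ℝ = ⟪symplecticJ n y, v⟫_ℝ) : u = v := by
  refine ext_inner_left ℝ fun y => ?_
  have := h (-symplecticJ n y)
  simpa using this

end SymplecticForm

/-! ### The gauge, its Hamiltonian field and the symplectic polar. -/

/-- The vector field that spans the characteristic direction: the vector dual, with respect to the
symplectic form, to the differential of the gauge function. -/
noncomputable def charField {n : ℕ} (K : Set (PhaseSpace n)) (x : PhaseSpace n) : PhaseSpace n :=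
  symplecticJ n (gradient (gauge K) x)

theorem inner_symplecticJ_charField {n : ℕ} (K : Set (PhaseSpace n)) (x y : PhaseSpace n) :
    ⟪symplecticJ n y, charField K x⟫_ℝ = fderiv ℝ (gauge K) x y := by
  rw [charField, inner_symplecticJ_symplecticJ, real_inner_comm, gradient,
    InnerProductSpace.toDual_symm_apply]

/-- `u` belongs to `a` times the polar body of `K`, polarity being taken with respect to the
symplectic form. -/
def SymplecticPolar {n : ℕ} (K : Set (PhaseSpace n)) (a : ℝ) (u : PhaseSpace n) : Prop :=
  ∀ y, ⟪symplecticJ n y, u⟫_ℝ ≤ a * gauge K y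

namespace IsSmoothStrictlyConvexSymmetricBody

variable {n : ℕ} {K : Set (PhaseSpace n)}

theorem convex (hK : IsSmoothStrictlyConvexSymmetricBody K) : Convex ℝ K := hK.strictConvex.convex

theorem mem_nhds_zero (hK : IsSmoothStrictlyConvexSymmetricBody K) : K ∈ 𝓝 (0 : PhaseSpace n) := by
  obtain ⟨x, hx⟩ := hK.interior_nonempty
  have hneg : -x ∈ K := hK.symmetric x (interior_subset hx)
  refine mem_interior_iff_mem_nhds.1 ?_
  refine hK.convex.openSegment_interior_self_subset_interior hx hneg ?_
  exact ⟨1 / 2, 1 / 2, by norm_num, by norm_num, by norm_num, by simp⟩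

theorem absorbent (hK : IsSmoothStrictlyConvexSymmetricBody K) : Absorbent ℝ K :=
  absorbent_nhds_zero hK.mem_nhds_zero

theorem gauge_neg (hK : IsSmoothStrictlyConvexSymmetricBody K) (x : PhaseSpace n) :
    gauge K (-x) = gauge K x :=
  _root_.gauge_neg hK.symmetric x

theorem gauge_smul (a : ℝ) (ha : 0 ≤ a) (x : PhaseSpace n) : gauge K (a • x) = a * gauge K x := by
  rw [gauge_smul_of_nonneg ha, smul_eq_mul]

theorem gauge_add_le (hK : IsSmoothStrictlyConvexSymmetricBody K) (x y : PhaseSpace n) :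
    gauge K (x + y) ≤ gauge K x + gauge K y :=
  _root_.gauge_add_le hK.convex hK.absorbent x y

theorem gauge_pos (hK : IsSmoothStrictlyConvexSymmetricBody K) {x : PhaseSpace n} :
    0 < gauge K x ↔ x ≠ 0 :=
  _root_.gauge_pos hK.absorbent
    ((NormedSpace.isVonNBounded_iff ℝ).2 hK.isCompact.isBounded)

theorem continuous_gauge (hK : IsSmoothStrictlyConvexSymmetricBody K) : Continuous (gauge K) :=
  _root_.continuous_gauge hK.convex hK.mem_nhds_zero

theorem exists_gauge_le (hK : IsSmoothStrictlyConvexSymmetricBody K) :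
    ∃ C : NNReal, ∀ x, gauge K x ≤ C * ‖x‖ := by
  obtain ⟨C, hC⟩ := hK.convex.lipschitz_gauge hK.mem_nhds_zero
  refine ⟨C, fun x => ?_⟩
  have := hC.dist_le_mul x 0
  rw [gauge_zero, dist_zero_right, dist_zero_right, Real.norm_of_nonneg (gauge_nonneg _)] at this
  exact this

theorem gauge_eq_one_iff (hK : IsSmoothStrictlyConvexSymmetricBody K) {x : PhaseSpace n} :
    gauge K x = 1 ↔ x ∈ frontier K :=
  gauge_eq_one_iff_mem_frontier hK.convex hK.mem_nhds_zero

theorem gauge_add_lt (hK : IsSmoothStrictlyConvexSymmetricBody K) {x y : PhaseSpace n} {r : ℝ}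
    (hr : 0 < r) (hx : gauge K x = r) (hy : gauge K y = r) (hxy : x ≠ y) :
    gauge K (x + y) < 2 * r := by
  have hmem : ∀ z, gauge K z = r → r⁻¹ • z ∈ K := fun z hz => by
    have h1 : gauge K (r⁻¹ • z) ≤ 1 := by
      rw [gauge_smul _ (inv_nonneg.2 hr.le), hz, inv_mul_cancel₀ hr.ne']
    rw [gauge_le_one_iff_mem_closure hK.convex hK.mem_nhds_zero,
      hK.isCompact.isClosed.closure_eq] at h1
    exact h1
  have hne : r⁻¹ • x ≠ r⁻¹ • y := fun h => hxy (smul_right_injective _ (inv_ne_zero hr.ne') h)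
  have hint := hK.strictConvex (hmem x hx) (hmem y hy) hne (a := 1 / 2) (b := 1 / 2)
    (by norm_num) (by norm_num) (by norm_num)
  have h1 : gauge K _ < 1 := interior_subset_gauge_lt_one K hint
  rw [← smul_add, ← smul_add, smul_smul, gauge_smul _ (by positivity)] at h1
  have h2 : gauge K (x + y) = 2 * r * (1 / 2 * r⁻¹ * gauge K (x + y)) := by
    field_simp
  rw [h2]
  exact mul_lt_of_lt_one_right (by positivity) h1

theorem differentiableAt_gauge (hK : IsSmoothStrictlyConvexSymmetricBody K) {x : PhaseSpace n}
    (hx : x ≠ 0) : DifferentiableAt ℝ (gauge K) x :=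
  ((hK.smooth.differentiableOn one_ne_zero) x hx).differentiableAt
    (isOpen_compl_singleton.mem_nhds hx)

theorem hasDerivAt_gauge_line (hK : IsSmoothStrictlyConvexSymmetricBody K) {x : PhaseSpace n}
    (hx : x ≠ 0) (y : PhaseSpace n) :
    HasDerivAt (fun t : ℝ => gauge K (x + t • y)) (fderiv ℝ (gauge K) x y) 0 := by
  have h1 : HasDerivAt (fun t : ℝ => x + t • y) y 0 := by
    simpa using ((hasDerivAt_id (0 : ℝ)).smul_const y).const_add x
  have h2 : HasFDerivAt (gauge K) (fderiv ℝ (gauge K) x) (x + (0 : ℝ) • y) := by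
    simpa using (hK.differentiableAt_gauge hx).hasFDerivAt
  exact h2.comp_hasDerivAt (0 : ℝ) h1

/-- Subadditivity bounds every difference quotient of `g` in direction `y` by `g y`. -/
theorem symplecticPolar_charField (hK : IsSmoothStrictlyConvexSymmetricBody K) {x : PhaseSpace n}
    (hx : x ≠ 0) : SymplecticPolar K 1 (charField K x) := fun y => by
  rw [inner_symplecticJ_charField, one_mul]
  refine le_of_tendsto (hK.hasDerivAt_gauge_line hx y).tendsto_slope_zero_right ?_
  filter_upwards [self_mem_nhdsWithin] with t ht
  have ht' : (0 : ℝ) < t := ht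
  have := hK.gauge_add_le x (t • y)
  rw [gauge_smul t ht'.le] at this
  simp only [zero_add, zero_smul, add_zero, smul_eq_mul]
  rw [inv_mul_le_iff₀ ht']
  linarith

/-- Euler's identity for the positively homogeneous function `g`. -/
theorem inner_symplecticJ_charField_self (hK : IsSmoothStrictlyConvexSymmetricBody K)
    {x : PhaseSpace n} (hx : x ≠ 0) : ⟪symplecticJ n x, charField K x⟫_ℝ = gauge K x := by
  rw [inner_symplecticJ_charField]
  refine (hK.hasDerivAt_gauge_line hx x).unique ?_
  have h1 : HasDerivAt (fun t : ℝ => (1 + t) * gauge K x) (gauge K x) 0 := by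
    simpa using ((hasDerivAt_id (0 : ℝ)).const_add 1).mul_const (gauge K x)
  refine h1.congr_of_eventuallyEq ?_
  filter_upwards [Ioi_mem_nhds (show (-1 : ℝ) < 0 by norm_num)] with t ht
  have ht' : (-1 : ℝ) < t := ht
  rw [← gauge_smul (K := K) (1 + t) (by linarith), add_smul, one_smul]

/-- Equality case of the polar inequality: the difference of its two sides is nonnegative and
vanishes at `x`, so its derivative there is zero, which determines `u`. -/
theorem eq_charField (hK : IsSmoothStrictlyConvexSymmetricBody K) {x u : PhaseSpace n}
    (hx : x ≠ 0) (hu : SymplecticPolar K 1 u) (hxu : ⟪symplecticJ n x, u⟫_ℝ = gauge K x) :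
    u = charField K x := by
  refine eq_of_inner_symplecticJ_eq fun y => ?_
  rw [inner_symplecticJ_charField]
  have h1 : HasDerivAt (fun t : ℝ => ⟪symplecticJ n (x + t • y), u⟫_ℝ) ⟪symplecticJ n y, u⟫_ℝ 0 := by
    simp only [map_add, map_smul, inner_add_left, real_inner_smul_left]
    simpa using ((hasDerivAt_id (0 : ℝ)).mul_const ⟪symplecticJ n y, u⟫_ℝ).const_add
      ⟪symplecticJ n x, u⟫_ℝ
  have hmin : IsLocalMin (fun t : ℝ => gauge K (x + t • y) - ⟪symplecticJ n (x + t • y), u⟫_ℝ) 0 := by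
    refine Eventually.of_forall fun t => ?_
    have := hu (x + t • y)
    simp only [zero_smul, add_zero, hxu, sub_self]
    linarith
  have := hmin.hasDerivAt_eq_zero ((hK.hasDerivAt_gauge_line hx y).sub h1)
  linarith

theorem charField_smul (hK : IsSmoothStrictlyConvexSymmetricBody K) {x : PhaseSpace n}
    (hx : x ≠ 0) {a : ℝ} (ha : 0 < a) : charField K (a • x) = charField K x := by
  refine (hK.eq_charField (smul_ne_zero ha.ne' hx) (hK.symplecticPolar_charField hx) ?_).symm
  rw [map_smul, real_inner_smul_left, hK.inner_symplecticJ_charField_self hx, gauge_smul a ha.le]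

theorem charField_neg (hK : IsSmoothStrictlyConvexSymmetricBody K) {x : PhaseSpace n}
    (hx : x ≠ 0) : charField K (-x) = -charField K x := by
  refine (hK.eq_charField (neg_ne_zero.2 hx) (fun y => ?_) ?_).symm
  · have := hK.symplecticPolar_charField hx (-y)
    rwa [map_neg, inner_neg_left, hK.gauge_neg, ← inner_neg_right] at this
  · rw [map_neg, inner_neg_neg, hK.inner_symplecticJ_charField_self hx, hK.gauge_neg]

/-- A common value `u` would give `ω(x + y, u) = 2r`, while strict convexity makes `g (x + y) < 2r`.
This is where strictness of the convexity is essential. -/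
theorem charField_injective (hK : IsSmoothStrictlyConvexSymmetricBody K) {x y : PhaseSpace n}
    {r : ℝ} (hr : 0 < r) (hx : gauge K x = r) (hy : gauge K y = r)
    (h : charField K x = charField K y) : x = y := by
  by_contra hne
  have hx0 : x ≠ 0 := hK.gauge_pos.1 (hx ▸ hr)
  have hy0 : y ≠ 0 := hK.gauge_pos.1 (hy ▸ hr)
  have h1 := hK.symplecticPolar_charField hx0 (x + y)
  rw [map_add, inner_add_left, hK.inner_symplecticJ_charField_self hx0, h,
    hK.inner_symplecticJ_charField_self hy0] at h1
  have := hK.gauge_add_lt hr hx hy hne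
  linarith

theorem continuousOn_charField (hK : IsSmoothStrictlyConvexSymmetricBody K) :
    ContinuousOn (charField K) {0}ᶜ := by
  have h1 := hK.smooth.continuousOn_fderiv_of_isOpen isOpen_compl_singleton le_rfl
  exact (symplecticJ n).continuous.comp_continuousOn
    ((InnerProductSpace.toDual ℝ (PhaseSpace n)).symm.continuous.comp_continuousOn h1)

theorem norm_le_of_symplecticPolar {C : NNReal}
    (hC : ∀ x, gauge K x ≤ C * ‖x‖) {a : ℝ} (ha : 0 ≤ a) {u : PhaseSpace n}
    (hu : SymplecticPolar K a u) : ‖u‖ ≤ a * C := by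
  -- This test vector turns the left side into `‖u‖ ^ 2`.
  have h1 := hu (-symplecticJ n u)
  rw [map_neg, symplecticJ_symplecticJ, neg_neg, real_inner_self_eq_norm_sq] at h1
  have h2 := hC (-symplecticJ n u)
  rw [norm_neg, norm_symplecticJ] at h2
  have h3 : ‖u‖ ^ 2 ≤ a * C * ‖u‖ := by nlinarith
  rcases (norm_nonneg u).eq_or_lt with h0 | h0
  · rw [← h0]; positivity
  · nlinarith

/-- The field `gauge K x • charField K x` is the Hamiltonian vector field of `gauge K ^ 2 / 2`; it
is continuous also at the origin. -/
theorem continuous_gauge_smul_charField (hK : IsSmoothStrictlyConvexSymmetricBody K) :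
    Continuous fun x => gauge K x • charField K x := by
  rw [continuous_iff_continuousAt]
  intro x
  by_cases hx : x = 0
  · subst hx
    obtain ⟨C, hC⟩ := hK.exists_gauge_le
    rw [ContinuousAt, gauge_zero, zero_smul]
    refine squeeze_zero_norm (a := fun x => gauge K x * C) (fun x => ?_) ?_
    · by_cases hx : x = 0
      · simp [hx]
      · rw [norm_smul, Real.norm_of_nonneg (gauge_nonneg _)]
        have := norm_le_of_symplecticPolar hC zero_le_one (hK.symplecticPolar_charField hx)
        rw [one_mul] at this
        exact mul_le_mul_of_nonneg_left this (gauge_nonneg _)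
    · have := (hK.continuous_gauge.mul_const (C : ℝ)).tendsto 0
      simpa using this
  · exact hK.continuous_gauge.continuousAt.smul
      ((hK.continuousOn_charField x hx).continuousAt (isOpen_compl_singleton.mem_nhds hx))

/-- The square is differentiable at the origin too. It serves to show that `g` is constant along a
curve not yet known to avoid the origin. -/
theorem hasFDerivAt_gauge_sq (hK : IsSmoothStrictlyConvexSymmetricBody K) (x : PhaseSpace n) :
    HasFDerivAt (fun x => gauge K x ^ 2)
      ((2 * gauge K x) • fderiv ℝ (gauge K) x) x := by
  by_cases hx : x = 0
  · subst hx
    obtain ⟨C, hC⟩ := hK.exists_gauge_le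
    rw [gauge_zero, mul_zero, zero_smul]
    refine HasFDerivAt.of_isLittleO ?_
    simp only [gauge_zero, sub_zero, zero_apply]
    have h1 : (fun x : PhaseSpace n => gauge K x) =O[𝓝 0] fun x => ‖x‖ :=
      Asymptotics.IsBigO.of_bound C (Eventually.of_forall fun x => by
        rw [Real.norm_of_nonneg (gauge_nonneg _), norm_norm]; exact hC x)
    have h2 : (fun x : PhaseSpace n => ‖x‖ ^ 2) =o[𝓝 0] fun x => x := by
      simpa using Asymptotics.isLittleO_norm_pow_id (E' := PhaseSpace n) one_lt_two
    simpa using (h1.pow 2).trans_isLittleO h2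
  · have := (hK.differentiableAt_gauge hx).hasFDerivAt.pow 2
    simpa using this

end IsSmoothStrictlyConvexSymmetricBody

/-! ### The action form on Lipschitz loops. -/

section LipschitzCurves

variable {n : ℕ} {C : NNReal} {z w y : ℝ → PhaseSpace n}

theorem LipschitzWith.intervalIntegrable_deriv (hw : LipschitzWith C w) (a b : ℝ) :
    IntervalIntegrable (deriv w) volume a b := by
  rw [intervalIntegrable_iff]
  refine Measure.integrableOn_of_bounded (M := C) ?_ (aestronglyMeasurable_deriv w _)
    (Eventually.of_forall fun t => norm_deriv_le_of_lipschitz hw)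
  simp [uIoc]

theorem IntervalIntegrable.inner_continuous {u v : ℝ → PhaseSpace n} {a b : ℝ}
    (hv : IntervalIntegrable v volume a b) (hu : Continuous u) :
    IntervalIntegrable (fun t => ⟪u t, v t⟫_ℝ) volume a b := by
  rw [intervalIntegrable_iff] at hv ⊢
  obtain ⟨M, hM⟩ := (isCompact_uIcc (a := a) (b := b)).exists_bound_of_continuousOn hu.continuousOn
  refine Integrable.mono' (g := fun t => M * ‖v t‖) (hv.norm.const_mul M)
    (hu.aestronglyMeasurable.inner hv.aestronglyMeasurable) ?_
  refine (ae_restrict_iff' measurableSet_uIoc).2 (Eventually.of_forall fun t ht => ?_)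
  exact (norm_inner_le_norm _ _).trans
    (mul_le_mul_of_nonneg_right (hM t (uIoc_subset_uIcc ht)) (norm_nonneg _))

theorem LipschitzWith.intervalIntegrable_inner_deriv (hz : Continuous z) (hw : LipschitzWith C w)
    (a b : ℝ) : IntervalIntegrable (fun t => ⟪symplecticJ n (z t), deriv w t⟫_ℝ) volume a b :=
  (hw.intervalIntegrable_deriv a b).inner_continuous ((symplecticJ n).continuous.comp hz)

theorem LipschitzWith.integral_deriv_eq_sub (hw : LipschitzWith C w) (a b : ℝ) :
    ∫ t in a..b, deriv w t = w b - w a := by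
  refine ext_inner_left ℝ fun v => ?_
  have hlip : LipschitzWith (‖innerSL ℝ v‖₊ * C) fun t => ⟪v, w t⟫_ℝ :=
    (innerSL ℝ v).lipschitz.comp hw
  have h1 := (hlip.lipschitzOnWith (s := uIcc a b)).absolutelyContinuousOnInterval.integral_deriv_eq_sub
  have h2 := (innerSL ℝ v).intervalIntegral_comp_comm (hw.intervalIntegrable_deriv a b)
  simp only [innerSL_apply_apply] at h2
  rw [← h2, inner_sub_right, ← h1]
  refine intervalIntegral.integral_congr_ae ?_
  filter_upwards [hw.ae_differentiableAt_real] with t ht _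
  have := (hasDerivAt_const t v).inner ℝ ht.hasDerivAt
  simpa using this.deriv.symm

theorem LipschitzWith.exists_lipschitzOnWith_inner (hz : LipschitzWith C z)
    (hw : LipschitzWith C w) (a b : ℝ) :
    ∃ D : NNReal, LipschitzOnWith D (fun t => ⟪symplecticJ n (z t), w t⟫_ℝ) (uIcc a b) := by
  obtain ⟨M, hM⟩ := (isCompact_uIcc (a := a) (b := b)).exists_bound_of_continuousOn
    hz.continuous.continuousOn
  obtain ⟨N, hN⟩ := (isCompact_uIcc (a := a) (b := b)).exists_bound_of_continuousOn
    hw.continuous.continuousOn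
  refine ⟨Real.toNNReal (M * C + C * N), LipschitzOnWith.of_dist_le_mul fun s hs t ht => ?_⟩
  have hM0 : 0 ≤ M := (norm_nonneg _).trans (hM s hs)
  have hN0 : 0 ≤ N := (norm_nonneg _).trans (hN s hs)
  rw [Real.coe_toNNReal _ (by positivity)]
  have h1 : ⟪symplecticJ n (z s), w s⟫_ℝ - ⟪symplecticJ n (z t), w t⟫_ℝ =
      ⟪symplecticJ n (z s), w s - w t⟫_ℝ + ⟪symplecticJ n (z s - z t), w t⟫_ℝ := by
    rw [map_sub, inner_sub_left, inner_sub_right]; ring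
  have h2 : ‖⟪symplecticJ n (z s), w s - w t⟫_ℝ‖ ≤ M * (C * dist s t) := by
    refine (norm_inner_le_norm _ _).trans ?_
    rw [norm_symplecticJ, ← dist_eq_norm]
    exact mul_le_mul (hM s hs) (hw.dist_le_mul s t) dist_nonneg hM0
  have h3 : ‖⟪symplecticJ n (z s - z t), w t⟫_ℝ‖ ≤ C * dist s t * N := by
    refine (norm_inner_le_norm _ _).trans ?_
    rw [norm_symplecticJ, ← dist_eq_norm]
    exact mul_le_mul (hz.dist_le_mul s t) (hN t ht) (norm_nonneg _) (by positivity)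
  rw [Real.dist_eq, h1]
  calc _ ≤ _ := norm_add_le _ _
    _ ≤ M * (C * dist s t) + C * dist s t * N := add_le_add h2 h3
    _ = _ := by ring

/-- The bilinear form on closed curves with parameter interval `[0, 1]` whose associated quadratic
form is twice the action. -/
noncomputable def loopForm (z w : ℝ → PhaseSpace n) : ℝ :=
  ∫ t in (0 : ℝ)..1, ⟪symplecticJ n (z t), deriv w t⟫_ℝ

/-- Integration by parts: `ω(z, w)` has equal values at both ends, and antisymmetry of `ω` supplies
the second sign. -/
theorem loopForm_comm (hz : LipschitzWith C z) (hw : LipschitzWith C w) (hz1 : z 1 = z 0)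
    (hw1 : w 1 = w 0) : loopForm z w = loopForm w z := by
  obtain ⟨D, hD⟩ := hz.exists_lipschitzOnWith_inner hw 0 1
  have h1 := hD.absolutelyContinuousOnInterval.integral_deriv_eq_sub
  rw [hz1, hw1, sub_self] at h1
  have h2 : ∫ t in (0 : ℝ)..1, deriv (fun t => ⟪symplecticJ n (z t), w t⟫_ℝ) t =
      ∫ t in (0 : ℝ)..1,
        (⟪symplecticJ n (z t), deriv w t⟫_ℝ - ⟪symplecticJ n (w t), deriv z t⟫_ℝ) := by
    refine intervalIntegral.integral_congr_ae ?_
    filter_upwards [hw.ae_differentiableAt_real, hz.ae_differentiableAt_real] with t ht ht' _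
    have := (((symplecticJ n).hasFDerivAt.comp_hasDerivAt t ht'.hasDerivAt)).inner ℝ ht.hasDerivAt
    have h3 := this.deriv
    simp only [Function.comp_def] at h3
    rw [h3, inner_symplecticJ_swap (deriv z t)]
    ring
  rw [h2, intervalIntegral.integral_sub (hw.intervalIntegrable_inner_deriv hz.continuous 0 1)
    (hz.intervalIntegrable_inner_deriv hw.continuous 0 1)] at h1
  exact sub_eq_zero.1 h1

theorem loopForm_add_left (hz : Continuous z) (hw : Continuous w) (hy : LipschitzWith C y) :
    loopForm (fun t => z t + w t) y = loopForm z y + loopForm w y := by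
  simp only [loopForm, map_add, inner_add_left]
  exact intervalIntegral.integral_add (hy.intervalIntegrable_inner_deriv hz 0 1)
    (hy.intervalIntegrable_inner_deriv hw 0 1)

theorem loopForm_smul_left (a : ℝ) : loopForm (fun t => a • z t) y = a * loopForm z y := by
  simp only [loopForm, map_smul, real_inner_smul_left, intervalIntegral.integral_const_mul]

theorem loopForm_const_left (c : PhaseSpace n) (hy : LipschitzWith C y) (hy1 : y 1 = y 0) :
    loopForm (fun _ => c) y = 0 := by
  have h2 := (innerSL ℝ (symplecticJ n c)).intervalIntegral_comp_comm
    (hy.intervalIntegrable_deriv 0 1)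
  simp only [innerSL_apply_apply] at h2
  rw [loopForm, h2, hy.integral_deriv_eq_sub, hy1, sub_self, inner_zero_right]

theorem loopForm_sub_left (hz : Continuous z) (hw : Continuous w) (hy : LipschitzWith C y) :
    loopForm (fun t => z t - w t) y = loopForm z y - loopForm w y := by
  have h1 := loopForm_add_left (w := fun t => (-1 : ℝ) • w t) hz (hw.const_smul (-1 : ℝ)) hy
  rw [loopForm_smul_left] at h1
  simpa [sub_eq_add_neg] using h1

theorem abs_loopForm_le {ε : ℝ} (hz : ∀ t ∈ Icc (0 : ℝ) 1, ‖z t‖ ≤ ε) (hw : LipschitzWith C w) :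
    |loopForm z w| ≤ ε * C := by
  have h1 := intervalIntegral.norm_integral_le_of_norm_le_const (a := 0) (b := 1) (C := ε * C)
    (f := fun t => ⟪symplecticJ n (z t), deriv w t⟫_ℝ) fun t ht => by
      rw [uIoc_of_le zero_le_one] at ht
      refine (norm_inner_le_norm _ _).trans ?_
      have h0 := hz t ⟨ht.1.le, ht.2⟩
      rw [norm_symplecticJ]
      exact mul_le_mul h0 (norm_deriv_le_of_lipschitz hw) (norm_nonneg _)
        ((norm_nonneg _).trans h0)
  simpa [loopForm] using h1

/-- By symmetry the difference is `loopForm (z - w) z + loopForm (z - w) w`, so uniform closeness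
suffices and derivatives need only be bounded. -/
theorem abs_loopForm_sub_le {ε : ℝ} (hz : LipschitzWith C z) (hw : LipschitzWith C w)
    (hz1 : z 1 = z 0) (hw1 : w 1 = w 0) (hzw : ∀ t ∈ Icc (0 : ℝ) 1, ‖z t - w t‖ ≤ ε) :
    |loopForm z z - loopForm w w| ≤ 2 * ε * C := by
  have h1 := abs_loopForm_le (z := fun t => z t - w t) hzw hz
  have h2 := abs_loopForm_le (z := fun t => z t - w t) hzw hw
  rw [loopForm_sub_left hz.continuous hw.continuous hz] at h1
  rw [loopForm_sub_left hz.continuous hw.continuous hw, loopForm_comm hz hw hz1 hw1] at h2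
  rw [abs_le] at h1 h2 ⊢
  constructor <;> linarith [h1.1, h1.2, h2.1, h2.2]

end LipschitzCurves

/-! ### Polar loops and the existence of a maximizer. -/

/-- `z` is a closed curve of period `1` whose velocity belongs to the symplectic polar of `K`. -/
structure IsPolarLoop {n : ℕ} (K : Set (PhaseSpace n)) (z : ℝ → PhaseSpace n) : Prop where
  periodic : Function.Periodic z 1
  polar : ∀ s t, s ≤ t → SymplecticPolar K (t - s) (z t - z s)

namespace IsPolarLoop

variable {n : ℕ} {K : Set (PhaseSpace n)} {z w : ℝ → PhaseSpace n}

theorem lipschitzWith (hz : IsPolarLoop K z) {C : NNReal} (hC : ∀ x, gauge K x ≤ C * ‖x‖) :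
    LipschitzWith C z := by
  have key : ∀ s t, s ≤ t → dist (z s) (z t) ≤ C * dist s t := fun s t hst => by
    rw [dist_comm, dist_eq_norm, dist_comm s t, Real.dist_eq, abs_of_nonneg (sub_nonneg.2 hst),
      mul_comm]
    exact IsSmoothStrictlyConvexSymmetricBody.norm_le_of_symplecticPolar hC (sub_nonneg.2 hst)
      (hz.polar s t hst)
  refine LipschitzWith.of_dist_le_mul fun s t => ?_
  rcases le_total s t with h | h
  · exact key s t h
  · rw [dist_comm, dist_comm s t]; exact key t s h

theorem one_eq_zero (hz : IsPolarLoop K z) : z 1 = z 0 := hz.periodic.eq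

theorem comp_add_right (hz : IsPolarLoop K z) (s : ℝ) : IsPolarLoop K fun t => z (t + s) where
  periodic := hz.periodic.add_const s
  polar a b hab := by
    have := hz.polar (a + s) (b + s) (by linarith)
    rwa [add_sub_add_right_eq_sub] at this

theorem sub_const (hz : IsPolarLoop K z) (c : PhaseSpace n) : IsPolarLoop K fun t => z t - c where
  periodic t := by simp only [hz.periodic t]
  polar a b hab := by simpa using hz.polar a b hab

theorem convex_comb (hz : IsPolarLoop K z) (hw : IsPolarLoop K w) {a b : ℝ} (ha : 0 ≤ a)
    (hb : 0 ≤ b) (hab : a + b = 1) : IsPolarLoop K fun t => a • z t + b • w t where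
  periodic t := by simp only [hz.periodic t, hw.periodic t]
  polar s t hst y := by
    have h1 := mul_le_mul_of_nonneg_left (hz.polar s t hst y) ha
    have h2 := mul_le_mul_of_nonneg_left (hw.polar s t hst y) hb
    have h3 : a • z t + b • w t - (a • z s + b • w s) = a • (z t - z s) + b • (w t - w s) := by
      module
    rw [h3, inner_add_right, real_inner_smul_right, real_inner_smul_right]
    calc _ ≤ _ := add_le_add h1 h2
      _ = (a + b) * ((t - s) * gauge K y) := by ring
      _ = _ := by rw [hab, one_mul]

theorem loopForm_sub_const (hK : IsSmoothStrictlyConvexSymmetricBody K) (hz : IsPolarLoop K z)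
    (c : PhaseSpace n) : loopForm (fun t => z t - c) (fun t => z t - c) = loopForm z z := by
  obtain ⟨C, hC⟩ := hK.exists_gauge_le
  have hl := hz.lipschitzWith hC
  have h1 : loopForm (fun t => z t - c) (fun t => z t - c) = loopForm (fun t => z t - c) z := by
    simp only [loopForm, deriv_sub_const]
  rw [h1, loopForm_sub_left hl.continuous continuous_const hl,
    loopForm_const_left c hl hz.one_eq_zero, sub_zero]

theorem symplecticPolar_deriv (hz : IsPolarLoop K z) {t : ℝ} (ht : DifferentiableAt ℝ z t) :
    SymplecticPolar K 1 (deriv z t) := fun y => by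
  have h1 := (hasDerivAt_const t (symplecticJ n y)).inner ℝ ht.hasDerivAt
  rw [inner_zero_left, add_zero] at h1
  refine le_of_tendsto h1.tendsto_slope_zero_right ?_
  filter_upwards [self_mem_nhdsWithin] with s hs
  have hs' : (0 : ℝ) < s := hs
  have := hz.polar t (t + s) (by linarith) y
  rw [smul_eq_mul, inv_mul_le_iff₀ hs', ← inner_sub_right]
  linarith

end IsPolarLoop

/-- Existence of maximizers of the action among the closed curves whose velocity belongs to the
symplectic polar of `K`. -/
theorem exists_isPolarLoop_forall_loopForm_le {n : ℕ} {K : Set (PhaseSpace n)}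
    (hK : IsSmoothStrictlyConvexSymmetricBody K) :
    ∃ z, IsPolarLoop K z ∧ ∀ w, IsPolarLoop K w → loopForm w w ≤ loopForm z z := by
  obtain ⟨C, hC⟩ := hK.exists_gauge_le
  set S : Set (ℝ → PhaseSpace n) := {z | IsPolarLoop K z ∧ z 0 = 0} with hS
  -- Stated through increments instead of derivatives, each condition involves at most two values of
  -- `z`, so it is closed for pointwise convergence.
  have hclosed : IsClosed S := by
    have : S = (⋂ t : ℝ, {z | z (t + 1) = z t}) ∩
        (⋂ (s : ℝ) (t : ℝ) (_ : s ≤ t) (y : PhaseSpace n),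
          {z | ⟪symplecticJ n y, z t - z s⟫_ℝ ≤ (t - s) * gauge K y}) ∩ {z | z 0 = 0} := by
      ext z
      simp only [hS, mem_ofPred_eq, mem_inter_iff, mem_iInter]
      exact ⟨fun h => ⟨⟨h.1.periodic, h.1.polar⟩, h.2⟩, fun h => ⟨⟨h.1.1, h.1.2⟩, h.2⟩⟩
    rw [this]
    refine ((isClosed_iInter fun t => ?_).inter (isClosed_iInter fun s => isClosed_iInter fun t =>
      isClosed_iInter fun _ => isClosed_iInter fun y => ?_)).inter ?_
    · exact isClosed_eq (continuous_apply _) (continuous_apply _)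
    · exact isClosed_le (continuous_const.inner ((continuous_apply t).sub (continuous_apply s)))
        continuous_const
    · exact isClosed_eq (continuous_apply _) continuous_const
  -- Tychonoff: the Lipschitz bound and `z 0 = 0` confine each value to a ball.
  have hcompact : IsCompact S := by
    refine (isCompact_univ_pi fun t : ℝ =>
      isCompact_closedBall (0 : PhaseSpace n) (C * |t|)).of_isClosed_subset hclosed ?_
    rintro z ⟨hz, hz0⟩ t -
    have := (hz.lipschitzWith hC).dist_le_mul t 0
    rwa [hz0, Real.dist_0_eq_abs] at this
  have hcont : ContinuousOn (fun z => loopForm z z) S := by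
    rintro z ⟨hz, -⟩
    have hzl := hz.lipschitzWith hC
    refine Metric.tendsto_nhds.2 fun ε hε => ?_
    -- Closeness at the grid points `j / N` and the common Lipschitz constant give uniform distance
    -- at most `(2C + 1) / N`; `N` is chosen so that the resulting bound on the forms is below `ε`.
    obtain ⟨N, hN⟩ := exists_nat_gt (2 * (2 * C + 1) * (C : ℝ) / ε)
    have hN0 : (0 : ℝ) < N := lt_of_le_of_lt (by positivity) hN
    have hev : ∀ᶠ w : ℝ → PhaseSpace n in 𝓝 z, ∀ j ∈ Finset.range (N + 1),
        dist (w (j / N)) (z (j / N)) < 1 / N := by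
      refine (Filter.eventually_all_finset _).2 fun j _ => ?_
      have hc : Continuous fun w : ℝ → PhaseSpace n => w (j / N) := continuous_apply _
      exact Metric.tendsto_nhds.1 (hc.tendsto z) _ (by positivity)
    filter_upwards [self_mem_nhdsWithin, nhdsWithin_le_nhds hev] with w hw hwz
    have hwl := hw.1.lipschitzWith hC
    have hunif : ∀ t ∈ Icc (0 : ℝ) 1, ‖w t - z t‖ ≤ (2 * C + 1) / N := fun t ht => by
      set j := ⌊t * N⌋₊ with hj
      have htN : 0 ≤ t * N := mul_nonneg ht.1 hN0.le
      have hj1 : (j : ℝ) ≤ t * N := Nat.floor_le htN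
      have hj2 : t * N < j + 1 := Nat.lt_floor_add_one _
      have hjN : j ∈ Finset.range (N + 1) := by
        rw [Finset.mem_range, Nat.lt_succ_iff]
        have : (j : ℝ) ≤ N := hj1.trans (mul_le_of_le_one_left hN0.le ht.2)
        exact_mod_cast this
      have hd : dist t (j / N) ≤ 1 / N := by
        rw [Real.dist_eq, abs_le]
        have e1 : t - j / N = (t * N - j) / N := by field_simp
        rw [e1]
        constructor
        · exact le_trans (by simp) (div_nonneg (sub_nonneg.2 hj1) hN0.le)
        · exact div_le_div_of_nonneg_right (by linarith) hN0.le
      have h1 := (hwl.dist_le_mul t (j / N)).trans (mul_le_mul_of_nonneg_left hd C.2)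
      have h2 := (hzl.dist_le_mul t (j / N)).trans (mul_le_mul_of_nonneg_left hd C.2)
      rw [← dist_eq_norm]
      have h3 := dist_triangle4 (w t) (w (j / N)) (z (j / N)) (z t)
      rw [dist_comm (z (j / N))] at h3
      have h4 := (hwz j hjN).le
      have : (2 * (C : ℝ) + 1) / N = C * (1 / N) + 1 / N + C * (1 / N) := by ring
      rw [this]
      linarith
    have h1 := abs_loopForm_sub_le hwl hzl hw.1.one_eq_zero hz.one_eq_zero hunif
    rw [Real.dist_eq]
    refine h1.trans_lt ?_
    rw [div_lt_iff₀ hε] at hN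
    have : 2 * ((2 * (C : ℝ) + 1) / N) * C = 2 * (2 * C + 1) * C / N := by ring
    rw [this, div_lt_iff₀ hN0]
    linarith
  have hne : S.Nonempty := by
    refine ⟨fun _ => 0, ⟨fun t => rfl, fun s t hst y => ?_⟩, rfl⟩
    rw [sub_self, inner_zero_right]
    exact mul_nonneg (sub_nonneg.2 hst) (gauge_nonneg _)
  obtain ⟨z, hz, hmax⟩ := hcompact.exists_isMaxOn hne hcont
  refine ⟨z, hz.1, fun w hw => ?_⟩
  rw [← hw.loopForm_sub_const hK (w 0)]
  exact hmax (show (fun t => w t - w 0) ∈ S from ⟨hw.sub_const (w 0), sub_self _⟩)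

/-! ### The Euler–Lagrange equation of a maximizer. -/

namespace IsSmoothStrictlyConvexSymmetricBody

variable {n : ℕ} {K : Set (PhaseSpace n)}

/-- Boundedness of `K` makes its polar a neighbourhood of the origin, which leaves room to perturb
velocities by small constants. -/
theorem exists_symplecticPolar_norm (hK : IsSmoothStrictlyConvexSymmetricBody K) :
    ∃ R : ℝ, 0 < R ∧ ∀ v : PhaseSpace n, SymplecticPolar K (R * ‖v‖) v := by
  obtain ⟨R, hR, hKR⟩ := hK.isCompact.isBounded.exists_pos_norm_le
  refine ⟨R, hR, fun v y => ?_⟩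
  have h1 : ‖y‖ / R ≤ gauge K y := le_gauge_of_subset_closedBall hK.absorbent hR.le
    (fun x hx => mem_closedBall_zero_iff.2 (hKR x hx))
  rw [div_le_iff₀ hR] at h1
  calc ⟪symplecticJ n y, v⟫_ℝ ≤ ‖symplecticJ n y‖ * ‖v‖ := real_inner_le_norm _ _
    _ = ‖y‖ * ‖v‖ := by rw [norm_symplecticJ]
    _ ≤ gauge K y * R * ‖v‖ := mul_le_mul_of_nonneg_right h1 (norm_nonneg _)
    _ = _ := by ring

end IsSmoothStrictlyConvexSymmetricBody

theorem SymplecticPolar.add {n : ℕ} {K : Set (PhaseSpace n)} {a b : ℝ} {u v : PhaseSpace n}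
    (hu : SymplecticPolar K a u) (hv : SymplecticPolar K b v) :
    SymplecticPolar K (a + b) (u + v) := fun y => by
  rw [inner_add_right, add_mul]
  exact add_le_add (hu y) (hv y)

theorem SymplecticPolar.smul {n : ℕ} {K : Set (PhaseSpace n)} {a b : ℝ} {u : PhaseSpace n}
    (hb : 0 ≤ b) (hu : SymplecticPolar K a u) : SymplecticPolar K (b * a) (b • u) := fun y => by
  rw [real_inner_smul_right, mul_assoc]
  exact mul_le_mul_of_nonneg_left (hu y) hb

theorem SymplecticPolar.mono {n : ℕ} {K : Set (PhaseSpace n)} {a b : ℝ} {u : PhaseSpace n}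
    (hab : a ≤ b) (hu : SymplecticPolar K a u) : SymplecticPolar K b u := fun y =>
  (hu y).trans (mul_le_mul_of_nonneg_right hab (gauge_nonneg y))

/-- `z` maximizes the action among the closed curves whose velocity belongs to the symplectic
polar of `K`. -/
structure IsMaximalPolarLoop {n : ℕ} (K : Set (PhaseSpace n)) (z : ℝ → PhaseSpace n) : Prop
    extends IsPolarLoop K z where
  loopForm_le : ∀ w, IsPolarLoop K w → loopForm w w ≤ loopForm z z

theorem intervalIntegral_inner_left {n : ℕ} {u : ℝ → PhaseSpace n} (hu : Continuous u)
    {v : PhaseSpace n} {a b : ℝ} : ∫ t in a..b, ⟪v, u t⟫_ℝ = ⟪v, ∫ t in a..b, u t⟫_ℝ := by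
  have := (innerSL ℝ v).intervalIntegral_comp_comm (hu.intervalIntegrable (μ := volume) a b)
  simpa only [innerSL_apply_apply] using this

/-- The primitive of a continuous field of mean zero with values in the symplectic polar. -/
theorem isPolarLoop_integral {n : ℕ} {K : Set (PhaseSpace n)} {u : ℝ → PhaseSpace n}
    (hu : Continuous u) (hper : Function.Periodic u 1) (h0 : ∫ t in (0 : ℝ)..1, u t = 0)
    (hpol : ∀ t, SymplecticPolar K 1 (u t)) : IsPolarLoop K fun t => ∫ s in (0 : ℝ)..t, u s where
  periodic t := by
    have h1 := intervalIntegral.integral_add_adjacent_intervals (hu.intervalIntegrable (μ := volume)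
      0 t) (hu.intervalIntegrable t (t + 1))
    have h2 := hper.intervalIntegral_add_eq t 0
    rw [zero_add, h0] at h2
    simp only [← h1, h2, add_zero]
  polar s t hst y := by
    rw [intervalIntegral.integral_interval_sub_left (hu.intervalIntegrable _ _)
      (hu.intervalIntegrable _ _)]
    rw [← intervalIntegral_inner_left hu]
    have h3 := intervalIntegral.integral_mono_on (μ := volume) hst
      ((continuous_const.inner hu).intervalIntegrable s t) intervalIntegrable_const
      fun τ _ => hpol τ y
    simpa using h3

namespace IsMaximalPolarLoop

variable {n : ℕ} {K : Set (PhaseSpace n)} {z w : ℝ → PhaseSpace n}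

/-- First variation along the segment from `z` to `w`. The form at parameter `s` exceeds that of `z`
by `s * (D - s * R)`, which would be positive for small `s` if `D > 0`. -/
theorem loopForm_le_of_isPolarLoop (hK : IsSmoothStrictlyConvexSymmetricBody K)
    (hz : IsMaximalPolarLoop K z) (hw : IsPolarLoop K w) : loopForm z w ≤ loopForm z z := by
  obtain ⟨C, hC⟩ := hK.exists_gauge_le
  have hzl := hz.lipschitzWith hC
  have hwl := hw.lipschitzWith hC
  by_contra! hlt
  set M := loopForm z z
  set B := loopForm z w with hB
  set D := 2 * (B - M) with hD
  set R := 2 * B - M - loopForm w w with hR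
  have hDpos : 0 < D := by linarith
  have key : ∀ s : ℝ, 0 < s → s < 1 → D ≤ s * R := fun s hs hs1 => by
    have hcomb := hz.convex_comb hw (sub_nonneg.2 hs1.le) hs.le (sub_add_cancel 1 s)
    have hcl := hcomb.lipschitzWith hC
    have h1 := hz.loopForm_le _ hcomb
    have hzc : Continuous fun t => (1 - s) • z t := hzl.continuous.const_smul (1 - s)
    have hwc : Continuous fun t => s • w t := hwl.continuous.const_smul s
    have e1 : ∀ {y : ℝ → PhaseSpace n}, LipschitzWith C y →
        loopForm (fun t => (1 - s) • z t + s • w t) y =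
          (1 - s) * loopForm z y + s * loopForm w y := fun hy => by
      rw [loopForm_add_left hzc hwc hy, loopForm_smul_left, loopForm_smul_left]
    rw [e1 hcl, loopForm_comm hzl hcl hz.one_eq_zero hcomb.one_eq_zero,
      loopForm_comm hwl hcl hw.one_eq_zero hcomb.one_eq_zero, e1 hzl, e1 hwl,
      loopForm_comm hwl hzl hw.one_eq_zero hz.one_eq_zero] at h1
    have h2 : s * (D - s * R) ≤ 0 := by
      rw [hD, hR]
      linear_combination h1
    have := nonpos_of_mul_nonpos_right h2 hs
    linarith
  have hpos : 0 < D + |R| + 1 := by positivity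
  -- This `s` lies in `(0, 1)` and satisfies `s * |R| < D`.
  have h1 := key (D / (D + |R| + 1)) (by positivity) (by rw [div_lt_one hpos]; linarith [abs_nonneg R])
  have h2 : D / (D + |R| + 1) * R ≤ D / (D + |R| + 1) * |R| :=
    mul_le_mul_of_nonneg_left (le_abs_self R) (by positivity)
  have h3 : D / (D + |R| + 1) * |R| < D := by
    rw [div_mul_eq_mul_div, div_lt_iff₀ hpos]
    nlinarith [abs_nonneg R]
  linarith

/-- The Lagrange multiplier for the constraint that the curve is closed. -/
theorem exists_multiplier (hK : IsSmoothStrictlyConvexSymmetricBody K)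
    (hz : IsMaximalPolarLoop K z) (hM : 0 < loopForm z z) :
    ∃ c : PhaseSpace n, ∀ (u : ℝ → PhaseSpace n) (ρ : ℝ), Continuous u → Function.Periodic u 1 →
      ρ < 1 → (∀ t, SymplecticPolar K ρ (u t)) →
      ∫ t in (0 : ℝ)..1, ⟪symplecticJ n (z t - c), u t⟫_ℝ ≤ loopForm z z := by
  obtain ⟨C, hC⟩ := hK.exists_gauge_le
  obtain ⟨R, hR, hRv⟩ := hK.exists_symplecticPolar_norm
  have hzl := hz.lipschitzWith hC
  have hJz : Continuous fun t => symplecticJ n (z t) := (symplecticJ n).continuous.comp hzl.continuous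
  set M := loopForm z z
  -- Pairs of the mean of a test velocity and a number strictly below its value. The strict
  -- inequalities make `S` open, and the first variation excludes `(0, M)`, since a velocity of mean
  -- zero integrates to a polar loop. A separating functional then yields the multiplier.
  set S : Set (PhaseSpace n × ℝ) := {p | ∃ (u : ℝ → PhaseSpace n) (ρ : ℝ), Continuous u ∧
    Function.Periodic u 1 ∧ ρ < 1 ∧ (∀ t, SymplecticPolar K ρ (u t)) ∧
    ∫ t in (0 : ℝ)..1, u t = p.1 ∧ p.2 < ∫ t in (0 : ℝ)..1, ⟪symplecticJ n (z t), u t⟫_ℝ} with hS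
  have hconv : Convex ℝ S := by
    rintro ⟨a₁, b₁⟩ ⟨u₁, ρ₁, hu₁, hper₁, hρ₁, hpol₁, ha₁, hb₁⟩
      ⟨a₂, b₂⟩ ⟨u₂, ρ₂, hu₂, hper₂, hρ₂, hpol₂, ha₂, hb₂⟩ α β hα hβ hαβ
    refine ⟨fun t => α • u₁ t + β • u₂ t, α * ρ₁ + β * ρ₂,
      (hu₁.const_smul α).add (hu₂.const_smul β), fun t => by simp only [hper₁ t, hper₂ t], ?_,
      fun t => ((hpol₁ t).smul hα).add ((hpol₂ t).smul hβ), ?_, ?_⟩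
    · rcases hα.eq_or_lt with rfl | hα'
      · obtain rfl : β = 1 := by linarith
        simpa using hρ₂
      · nlinarith
    · have h1 := intervalIntegral.integral_add (μ := volume) (f := fun t => α • u₁ t)
        (g := fun t => β • u₂ t) ((hu₁.const_smul α).intervalIntegrable 0 1)
        ((hu₂.const_smul β).intervalIntegrable 0 1)
      rw [intervalIntegral.integral_smul, intervalIntegral.integral_smul, ha₁, ha₂] at h1
      exact h1
    · simp only [inner_add_right, real_inner_smul_right]
      rw [intervalIntegral.integral_add (((hJz.inner hu₁).const_mul α).intervalIntegrable _ _)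
        (((hJz.inner hu₂).const_mul β).intervalIntegrable _ _),
        intervalIntegral.integral_const_mul, intervalIntegral.integral_const_mul]
      change α * b₁ + β * b₂ < _
      rcases hα.eq_or_lt with rfl | hα'
      · obtain rfl : β = 1 := by linarith
        simpa using hb₂
      · exact add_lt_add_of_lt_of_le (mul_lt_mul_of_pos_left hb₁ hα')
          (mul_le_mul_of_nonneg_left hb₂.le hβ)
  have hopen : IsOpen S := by
    refine isOpen_iff_mem_nhds.2 ?_
    rintro ⟨a, b⟩ ⟨u, ρ, hu, hper, hρ, hpol, ha, hb⟩
    set q := ∫ t in (0 : ℝ)..1, symplecticJ n (z t) with hq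
    have h1 : ∀ᶠ p : PhaseSpace n × ℝ in 𝓝 (a, b), ρ + R * ‖p.1 - a‖ < 1 := by
      have hc : Continuous fun p : PhaseSpace n × ℝ => ρ + R * ‖p.1 - a‖ := by fun_prop
      exact hc.continuousAt.eventually_lt continuousAt_const (by simpa using hρ)
    have h2 : ∀ᶠ p : PhaseSpace n × ℝ in 𝓝 (a, b),
        p.2 < (∫ t in (0 : ℝ)..1, ⟪symplecticJ n (z t), u t⟫_ℝ) + ⟪p.1 - a, q⟫_ℝ := by
      have hc : Continuous fun p : PhaseSpace n × ℝ =>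
        (∫ t in (0 : ℝ)..1, ⟪symplecticJ n (z t), u t⟫_ℝ) + ⟪p.1 - a, q⟫_ℝ := by fun_prop
      exact continuousAt_snd.eventually_lt hc.continuousAt (by simpa using hb)
    filter_upwards [h1, h2] with p hp1 hp2
    refine ⟨fun t => u t + (p.1 - a), ρ + R * ‖p.1 - a‖, hu.add continuous_const,
      fun t => by simp only [hper t], hp1, fun t => (hpol t).add (hRv _), ?_, ?_⟩
    · rw [intervalIntegral.integral_add (hu.intervalIntegrable _ _) intervalIntegrable_const, ha]
      simp
    · simp only [inner_add_right]
      rw [intervalIntegral.integral_add ((hJz.inner hu).intervalIntegrable _ _)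
        ((hJz.inner continuous_const).intervalIntegrable _ _)]
      rw [hq, ← intervalIntegral_inner_left hJz] at hp2
      simpa only [real_inner_comm (p.1 - a)] using hp2
  have hnot : ((0 : PhaseSpace n), M) ∉ S := by
    rintro ⟨u, ρ, hu, hper, hρ, hpol, ha, hb⟩
    have hw := isPolarLoop_integral hu hper ha fun t => (hpol t).mono hρ.le
    have h1 := hz.loopForm_le_of_isPolarLoop hK hw
    have h2 : (deriv fun t => ∫ s in (0 : ℝ)..t, u s) = u :=
      funext fun t => hu.deriv_integral u 0 t
    rw [loopForm, h2] at h1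
    exact (not_le.2 hb) h1
  obtain ⟨f, hf⟩ := geometric_hahn_banach_open_point hconv hopen hnot
  set μ := f (0, 1) with hμ
  set p := (InnerProductSpace.toDual ℝ (PhaseSpace n)).symm
    (f.comp (ContinuousLinearMap.inl ℝ (PhaseSpace n) ℝ)) with hp
  have hfab : ∀ a b, f (a, b) = ⟪p, a⟫_ℝ + b * μ := fun a b => by
    rw [hp, InnerProductSpace.toDual_symm_apply, hμ, ← smul_eq_mul, ← map_smul]
    simp [← map_add]
  -- The separating hyperplane is not vertical, because `(0, -M)` lies in `S` and `M > 0`.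
  have hμpos : 0 < μ := by
    have h1 : ((0 : PhaseSpace n), -M) ∈ S := by
      refine ⟨fun _ => 0, 0, continuous_const, fun _ => rfl, zero_lt_one, fun t y => by simp,
        by simp, by simpa using hM⟩
    have h2 := hf _ h1
    rw [hfab, hfab, inner_zero_right] at h2
    nlinarith
  -- Since `J² = -1`, subtracting this centre from `z` adds exactly `μ⁻¹ * ⟪p, u⟫` to the integrand.
  refine ⟨μ⁻¹ • symplecticJ n p, fun u ρ hu hper hρ hpol => ?_⟩
  set I := ∫ t in (0 : ℝ)..1, ⟪symplecticJ n (z t), u t⟫_ℝ with hI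
  have h1 : ∀ b < I, ⟪p, ∫ t in (0 : ℝ)..1, u t⟫_ℝ + b * μ ≤ M * μ := fun b hb => by
    have h2 := hf (∫ t in (0 : ℝ)..1, u t, b) ⟨u, ρ, hu, hper, hρ, hpol, rfl, hb⟩
    rw [hfab, hfab, inner_zero_right, zero_add] at h2
    exact h2.le
  have h2 : I ≤ (M * μ - ⟪p, ∫ t in (0 : ℝ)..1, u t⟫_ℝ) / μ := by
    refine le_of_forall_lt fun b hb => ?_
    obtain ⟨b', hb', hb'I⟩ := exists_between hb
    refine hb'.trans_le ?_
    rw [le_div_iff₀ hμpos]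
    linarith [h1 b' hb'I]
  have h4 : ∀ t, ⟪symplecticJ n (z t - μ⁻¹ • symplecticJ n p), u t⟫_ℝ =
      ⟪symplecticJ n (z t), u t⟫_ℝ + μ⁻¹ * ⟪p, u t⟫_ℝ := fun t => by
    simp [inner_add_left, real_inner_smul_left]
  simp only [h4]
  rw [intervalIntegral.integral_add ((hJz.inner hu).intervalIntegrable _ _)
    (((continuous_const.inner hu).const_mul _).intervalIntegrable _ _),
    intervalIntegral.integral_const_mul, intervalIntegral_inner_left hu, ← hI]
  rw [sub_div, mul_div_cancel_right₀ _ hμpos.ne'] at h2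
  rw [inv_mul_eq_div]
  linarith

end IsMaximalPolarLoop

namespace IsMaximalPolarLoop

variable {n : ℕ} {K : Set (PhaseSpace n)} {z : ℝ → PhaseSpace n}

/-- The ideal test velocity in the multiplier inequality is `charField K (z - c)`, for which the
integrand is `g (z - c)`. It may be discontinuous where `z = c`, so it is damped there, scaled by `1
- ε`, and `ε` tends to zero. -/
theorem exists_integral_gauge_le (hK : IsSmoothStrictlyConvexSymmetricBody K)
    (hz : IsMaximalPolarLoop K z) (hM : 0 < loopForm z z) :
    ∃ c : PhaseSpace n, ∫ t in (0 : ℝ)..1, gauge K (z t - c) ≤ loopForm z z := by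
  obtain ⟨C, hC⟩ := hK.exists_gauge_le
  have hzc := (hz.lipschitzWith hC).continuous
  obtain ⟨c, hc⟩ := hz.exists_multiplier hK hM
  refine ⟨c, ?_⟩
  set I := ∫ t in (0 : ℝ)..1, gauge K (z t - c)
  have hyc : Continuous fun t => z t - c := hzc.sub continuous_const
  have hGc : Continuous fun t => gauge K (z t - c) := hK.continuous_gauge.comp hyc
  have key : ∀ ε : ℝ, 0 < ε → ε < 1 → (1 - ε) * (I - ε) ≤ loopForm z z := fun ε hε hε1 => by
    set θ : ℝ → ℝ := fun t => (1 - ε) / max (gauge K (z t - c)) ε with hθ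
    have hmax : ∀ t, 0 < max (gauge K (z t - c)) ε := fun t => lt_max_of_lt_right hε
    have hθc : Continuous θ :=
      continuous_const.div (hGc.max continuous_const) fun t => (hmax t).ne'
    set u : ℝ → PhaseSpace n :=
      fun t => θ t • (gauge K (z t - c) • charField K (z t - c)) with hu
    have huc : Continuous u :=
      hθc.smul (hK.continuous_gauge_smul_charField.comp hyc)
    have hθG : ∀ t, θ t * gauge K (z t - c) ≤ 1 - ε := fun t => by
      rw [hθ, div_mul_eq_mul_div, div_le_iff₀ (hmax t)]
      exact mul_le_mul_of_nonneg_left (le_max_left _ _) (by linarith)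
    have hθ0 : ∀ t, 0 ≤ θ t := fun t => div_nonneg (by linarith) (hmax t).le
    have hpol : ∀ t, SymplecticPolar K (1 - ε) (u t) := fun t => by
      by_cases h0 : z t - c = 0
      · intro y
        simp only [hu, h0, gauge_zero, zero_smul, smul_zero, inner_zero_right]
        exact mul_nonneg (by linarith) (gauge_nonneg _)
      · have h1 := ((hK.symplecticPolar_charField h0).smul
          (gauge_nonneg (s := K) (z t - c))).smul (hθ0 t)
        rw [mul_one] at h1
        exact h1.mono (hθG t)
    -- With `G = g (z t - c)` this is the elementary bound `G ^ 2 / max G ε ≥ G - ε`.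
    have hlow : ∀ t, (1 - ε) * (gauge K (z t - c) - ε) ≤ ⟪symplecticJ n (z t - c), u t⟫_ℝ :=
      fun t => by
        have h1 : ⟪symplecticJ n (z t - c), u t⟫_ℝ =
            (1 - ε) * (gauge K (z t - c) ^ 2 / max (gauge K (z t - c)) ε) := by
          by_cases h0 : z t - c = 0
          · simp [hu, h0]
          · rw [hu, real_inner_smul_right, real_inner_smul_right,
              hK.inner_symplecticJ_charField_self h0, hθ]
            ring
        rw [h1]
        refine mul_le_mul_of_nonneg_left ?_ (by linarith)
        rw [le_div_iff₀ (hmax t)]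
        have hG := gauge_nonneg (s := K) (z t - c)
        rcases max_cases (gauge K (z t - c)) ε with ⟨h, -⟩ | ⟨h, h'⟩ <;> rw [h] <;> nlinarith
    have hper : Function.Periodic u 1 := fun t => by simp only [hu, hθ, hz.periodic t]
    have h1 := hc u (1 - ε) huc hper (by linarith) hpol
    refine le_trans ?_ h1
    have h2 := intervalIntegral.integral_mono_on (μ := volume)
      (f := fun t => (1 - ε) * (gauge K (z t - c) - ε))
      (g := fun t => ⟪symplecticJ n (z t - c), u t⟫_ℝ) zero_le_one
      ((continuous_const.mul (hGc.sub continuous_const)).intervalIntegrable 0 1)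
      ((((symplecticJ n).continuous.comp hyc).inner huc).intervalIntegrable 0 1)
      fun t _ => hlow t
    rw [intervalIntegral.integral_const_mul, intervalIntegral.integral_sub
      (hGc.intervalIntegrable _ _) intervalIntegrable_const] at h2
    simpa using h2
  have hlim : Tendsto (fun ε : ℝ => (1 - ε) * (I - ε)) (𝓝[>] 0) (𝓝 I) := by
    have hcont : Continuous fun ε : ℝ => (1 - ε) * (I - ε) := by fun_prop
    have := (hcont.tendsto 0).mono_left (nhdsWithin_le_nhds (s := Ioi 0))
    simpa using this
  refine le_of_tendsto hlim ?_
  filter_upwards [Ioo_mem_nhdsGT (show (0 : ℝ) < 1 from zero_lt_one)] with ε hε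
  exact key ε hε.1 hε.2

/-- Up to a translation, a maximizer is a characteristic on a dilate of the boundary of `K`. -/
theorem exists_hasDerivAt (hK : IsSmoothStrictlyConvexSymmetricBody K)
    (hz : IsMaximalPolarLoop K z) (hM : 0 < loopForm z z) :
    ∃ c : PhaseSpace n, ∀ t, gauge K (z t - c) = loopForm z z ∧
      HasDerivAt z (charField K (z t - c)) t := by
  obtain ⟨C, hC⟩ := hK.exists_gauge_le
  have hzl := hz.lipschitzWith hC
  obtain ⟨c, hc⟩ := hz.exists_integral_gauge_le hK hM
  refine ⟨c, ?_⟩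
  have hyc : Continuous fun t => z t - c := hzl.continuous.sub continuous_const
  have hGc : Continuous fun t => gauge K (z t - c) := hK.continuous_gauge.comp hyc
  have hform : loopForm z z = ∫ t in (0 : ℝ)..1, ⟪symplecticJ n (z t - c), deriv z t⟫_ℝ := by
    have := loopForm_sub_left hzl.continuous (continuous_const (y := c)) hzl
    rw [loopForm_const_left c hzl hz.one_eq_zero, sub_zero] at this
    exact this.symm
  have hint := hzl.intervalIntegrable_inner_deriv hyc 0 1
  have hae1 : ∀ᵐ t, SymplecticPolar K 1 (deriv z t) := by
    filter_upwards [hzl.ae_differentiableAt_real] with t ht using hz.symplecticPolar_deriv ht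
  -- The integrand is nonnegative by polarity and its integral is at most zero by the choice of `c`;
  -- hence the polar inequality is an equality almost everywhere.
  have hae2 : ∀ᵐ t ∂volume.restrict (Ioc (0 : ℝ) 1),
      gauge K (z t - c) - ⟪symplecticJ n (z t - c), deriv z t⟫_ℝ = 0 := by
    have h0 : 0 ≤ᵐ[volume.restrict (Ioc (0 : ℝ) 1)]
        fun t => gauge K (z t - c) - ⟪symplecticJ n (z t - c), deriv z t⟫_ℝ := by
      refine ae_restrict_of_ae ?_
      filter_upwards [hae1] with t ht
      have := ht (z t - c)
      rw [one_mul] at this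
      exact sub_nonneg.2 this
    have hi := (hGc.intervalIntegrable (μ := volume) 0 1).sub hint
    rw [intervalIntegrable_iff_integrableOn_Ioc_of_le zero_le_one] at hi
    refine (integral_eq_zero_iff_of_nonneg_ae h0 hi).1 (le_antisymm ?_ (integral_nonneg_of_ae h0))
    rw [← intervalIntegral.integral_of_le zero_le_one,
      intervalIntegral.integral_sub (hGc.intervalIntegrable 0 1) hint, ← hform]
    linarith
  rw [ae_restrict_iff' measurableSet_Ioc] at hae2
  have hmem : ∀ t ∈ Icc (0 : ℝ) 1, uIoc 0 t ⊆ Ioc (0 : ℝ) 1 := fun t ht => by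
    rw [uIoc_of_le ht.1]; exact Ioc_subset_Ioc_right ht.2
  have hchar : ∀ᵐ t, t ∈ Ioc (0 : ℝ) 1 → z t - c ≠ 0 → deriv z t = charField K (z t - c) := by
    filter_upwards [hae1, hae2] with t h1 h2 ht h0
    exact hK.eq_charField h0 h1 (sub_eq_zero.1 (h2 ht)).symm
  -- Conservation of energy: the derivative of `g ^ 2` vanishes almost everywhere, through `ω(X, X)
  -- = 0` away from the centre and through the factor `g` at it.
  have hconst : ∀ t ∈ Icc (0 : ℝ) 1, gauge K (z t - c) = gauge K (z 0 - c) := fun t ht => by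
    obtain ⟨D, hD⟩ := hK.convex.lipschitz_gauge hK.mem_nhds_zero
    have hac : AbsolutelyContinuousOnInterval (fun t => gauge K (z t - c)) 0 t :=
      ((hD.comp (hzl.sub (LipschitzWith.const c))).lipschitzOnWith).absolutelyContinuousOnInterval
    have h1 := (hac.fun_mul hac).integral_deriv_eq_sub
    have h2 : ∫ s in (0 : ℝ)..t, deriv (fun t => gauge K (z t - c) * gauge K (z t - c)) s = 0 := by
      refine (intervalIntegral.integral_congr_ae (g := fun _ => (0 : ℝ)) ?_).trans (by simp)
      filter_upwards [hchar, hzl.ae_differentiableAt_real] with s hs hsd hmem'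
      have h3 := (hK.hasFDerivAt_gauge_sq (z s - c)).comp_hasDerivAt s (hsd.hasDerivAt.sub_const c)
      have h4 := h3.deriv
      simp only [Function.comp_def, pow_two] at h4
      rw [h4, smul_apply, ← inner_symplecticJ_charField]
      by_cases h0 : z s - c = 0
      · simp [h0]
      · rw [hs (hmem t ht hmem') h0, inner_symplecticJ_self, smul_zero]
    rw [h2] at h1
    have h5 : gauge K (z t - c) ^ 2 = gauge K (z 0 - c) ^ 2 := by linarith
    exact (sq_eq_sq₀ (gauge_nonneg _) (gauge_nonneg _)).1 h5
  have hr : gauge K (z 0 - c) = loopForm z z := by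
    have h1 : ∫ t in (0 : ℝ)..1, gauge K (z t - c) = loopForm z z := by
      rw [hform]
      refine intervalIntegral.integral_congr_ae ?_
      filter_upwards [hae2] with t ht ht'
      rw [uIoc_of_le zero_le_one] at ht'
      exact sub_eq_zero.1 (ht ht')
    rw [← h1, intervalIntegral.integral_congr (g := fun _ => gauge K (z 0 - c)) fun t ht =>
      hconst t (by rwa [uIcc_of_le zero_le_one] at ht)]
    simp
  have hfract : ∀ t : ℝ, z (Int.fract t) = z t := fun t => by
    have := hz.periodic.sub_int_mul_eq (x := t) ⌊t⌋
    rwa [mul_one] at this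
  have hgauge : ∀ t, gauge K (z t - c) = loopForm z z := fun t => by
    rw [← hfract, hconst _ ⟨Int.fract_nonneg t, (Int.fract_lt_one t).le⟩, hr]
  have hne : ∀ t, z t - c ≠ 0 := fun t => hK.gauge_pos.1 (hgauge t ▸ hM)
  have hXc : Continuous fun t => charField K (z t - c) :=
    hK.continuousOn_charField.comp_continuous hyc hne
  -- The equation known almost everywhere has a continuous right side, so integrating it gives
  -- differentiability everywhere.
  have hftc : ∀ t ∈ Icc (0 : ℝ) 1, z t = z 0 + ∫ s in (0 : ℝ)..t, charField K (z s - c) :=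
    fun t ht => by
      rw [← sub_eq_iff_eq_add', ← hzl.integral_deriv_eq_sub]
      refine intervalIntegral.integral_congr_ae ?_
      filter_upwards [hchar] with s hs hs'
      exact hs (hmem t ht hs') (hne s)
  have h01 : ∫ s in (0 : ℝ)..1, charField K (z s - c) = 0 := by
    have := hftc 1 ⟨zero_le_one, le_rfl⟩
    rwa [hz.one_eq_zero, left_eq_add] at this
  have hloop := isPolarLoop_integral hXc (fun t => by simp only [hz.periodic t]) h01
    fun t => hK.symplecticPolar_charField (hne t)
  have hall : z = fun t => z 0 + ∫ s in (0 : ℝ)..t, charField K (z s - c) := funext fun t => by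
    have h1 := hloop.periodic.sub_int_mul_eq (x := t) ⌊t⌋
    rw [mul_one] at h1
    rw [← h1, ← hfract t]
    exact hftc _ ⟨Int.fract_nonneg t, (Int.fract_lt_one t).le⟩
  refine fun t => ⟨hgauge t, ?_⟩
  have h1 := (hXc.integral_hasStrictDerivAt 0 t).hasDerivAt.const_add (z 0)
  rwa [← hall] at h1

end IsMaximalPolarLoop

/-! ### Halving and reflecting a maximizer. -/

theorem SymplecticPolar.neg {n : ℕ} {K : Set (PhaseSpace n)} {a : ℝ} {u : PhaseSpace n}
    (hu : SymplecticPolar K a u) (hK : IsSmoothStrictlyConvexSymmetricBody K) :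
    SymplecticPolar K a (-u) := fun y => by
  have := hu (-y)
  rwa [map_neg, inner_neg_left, hK.gauge_neg, ← inner_neg_right] at this

/-- The periodic extension of a closed curve. -/
theorem isPolarLoop_comp_fract {n : ℕ} {K : Set (PhaseSpace n)} {f : ℝ → PhaseSpace n}
    (hf : ∀ s t, 0 ≤ s → s ≤ t → t ≤ 1 → SymplecticPolar K (t - s) (f t - f s)) (h01 : f 0 = f 1) :
    IsPolarLoop K fun t => f (Int.fract t) where
  periodic t := by simp only [Int.fract_add_one]
  polar s t hst := by
    have hs := Int.floor_add_fract s
    have ht := Int.floor_add_fract t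
    rcases (Int.floor_mono hst).eq_or_lt with h | h
    · rw [h] at hs
      have h1 : t - s = Int.fract t - Int.fract s := by linarith
      rw [h1]
      exact hf _ _ (Int.fract_nonneg s) (by linarith) (Int.fract_lt_one t).le
    -- The increment splits at the junction `f 0 = f 1`; any full periods in between only enlarge `t
    -- - s`.
    · have h' : (⌊s⌋ : ℝ) + 1 ≤ ⌊t⌋ := by exact_mod_cast h
      have h1 := (hf 0 (Int.fract t) le_rfl (Int.fract_nonneg t) (Int.fract_lt_one t).le).add
        (hf (Int.fract s) 1 (Int.fract_nonneg s) (Int.fract_lt_one s).le le_rfl)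
      rw [h01, sub_add_sub_cancel] at h1
      exact h1.mono (by linarith)

/-- The first half of the closed curve `z`, of period `1`, followed by its image under the point
reflection that exchanges the end points of this half. -/
noncomputable def reflectedHalf {n : ℕ} (z : ℝ → PhaseSpace n) (t : ℝ) : PhaseSpace n :=
  if Int.fract t ≤ 1 / 2 then z (Int.fract t) else z 0 + z (1 / 2) - z (Int.fract t - 1 / 2)

section ReflectedHalf

variable {n : ℕ} {K : Set (PhaseSpace n)} {z : ℝ → PhaseSpace n}

theorem IsPolarLoop.reflectedHalf (hz : IsPolarLoop K z)
    (hK : IsSmoothStrictlyConvexSymmetricBody K) : IsPolarLoop K (reflectedHalf z) := by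
  refine isPolarLoop_comp_fract
    (f := fun t => if t ≤ 1 / 2 then z t else z 0 + z (1 / 2) - z (t - 1 / 2))
    (fun s t _ hst _ => ?_) ?_
  · by_cases h1 : t ≤ 1 / 2
    · simp only [if_pos h1, if_pos (hst.trans h1)]
      exact hz.polar s t hst
    · have h1' := not_le.1 h1
      by_cases h2 : s ≤ 1 / 2
      · simp only [if_neg h1, if_pos h2]
        have h3 := ((hz.polar 0 (t - 1 / 2) (by linarith)).neg hK).add (hz.polar s (1 / 2) h2)
        have e1 : t - 1 / 2 - 0 + (1 / 2 - s) = t - s := by ring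
        have e2 : -(z (t - 1 / 2) - z 0) + (z (1 / 2) - z s) =
            z 0 + z (1 / 2) - z (t - 1 / 2) - z s := by abel
        rwa [e1, e2] at h3
      · simp only [if_neg h1, if_neg h2]
        have h3 := (hz.polar (s - 1 / 2) (t - 1 / 2) (by linarith)).neg hK
        rwa [sub_sub_sub_cancel_right, neg_sub, ← sub_sub_sub_cancel_left _ _ (z 0 + z (1 / 2))]
          at h3
  · norm_num

theorem reflectedHalf_eventuallyEq_left {t : ℝ} (ht : t ∈ Ioo (0 : ℝ) (1 / 2)) :
    reflectedHalf z =ᶠ[𝓝 t] z := by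
  filter_upwards [Ioo_mem_nhds ht.1 ht.2] with s hs
  have h1 : Int.fract s = s := Int.fract_eq_self.2 ⟨hs.1.le, by linarith [hs.2]⟩
  rw [reflectedHalf, h1, if_pos hs.2.le]

theorem reflectedHalf_eventuallyEq_right {t : ℝ} (ht : t ∈ Ioo (1 / 2 : ℝ) 1) :
    reflectedHalf z =ᶠ[𝓝 t] fun s => z 0 + z (1 / 2) - z (s - 1 / 2) := by
  filter_upwards [Ioo_mem_nhds ht.1 ht.2] with s hs
  have h1 : Int.fract s = s := Int.fract_eq_self.2 ⟨by linarith [hs.1], hs.2⟩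
  rw [reflectedHalf, h1, if_neg (not_le.2 hs.1)]

/-- The reflected arc contributes the same integral as the original one, apart from the constant `z
0 + z (1/2)`, which integrates to the chord term. -/
theorem loopForm_reflectedHalf (hK : IsSmoothStrictlyConvexSymmetricBody K)
    (hz : IsPolarLoop K z) : loopForm (reflectedHalf z) (reflectedHalf z) =
      2 * (∫ t in (0 : ℝ)..(1 / 2), ⟪symplecticJ n (z t), deriv z t⟫_ℝ) -
        2 * ⟪symplecticJ n (z 0), z (1 / 2)⟫_ℝ := by
  obtain ⟨C, hC⟩ := hK.exists_gauge_le
  have hzl := hz.lipschitzWith hC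
  have hrl := (hz.reflectedHalf hK).lipschitzWith hC
  have hint := hrl.intervalIntegrable_inner_deriv hrl.continuous
  rw [loopForm, ← intervalIntegral.integral_add_adjacent_intervals (hint 0 (1 / 2)) (hint (1 / 2) 1)]
  have h1 : ∫ t in (0 : ℝ)..(1 / 2),
      ⟪symplecticJ n (reflectedHalf z t), deriv (reflectedHalf z) t⟫_ℝ =
        ∫ t in (0 : ℝ)..(1 / 2), ⟪symplecticJ n (z t), deriv z t⟫_ℝ := by
    refine intervalIntegral.integral_congr_Ioo_of_le (by norm_num) fun t ht => ?_
    have h := reflectedHalf_eventuallyEq_left (z := z) ht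
    simp only [h.eq_of_nhds, h.deriv_eq]
  have h2 : ∫ t in (1 / 2 : ℝ)..1,
      ⟪symplecticJ n (reflectedHalf z t), deriv (reflectedHalf z) t⟫_ℝ =
        ∫ t in (1 / 2 : ℝ)..1, (⟪symplecticJ n (z (t - 1 / 2)), deriv z (t - 1 / 2)⟫_ℝ -
          ⟪symplecticJ n (z 0 + z (1 / 2)), deriv z (t - 1 / 2)⟫_ℝ) := by
    refine intervalIntegral.integral_congr_Ioo_of_le (by norm_num) fun t ht => ?_
    have h := reflectedHalf_eventuallyEq_right (z := z) ht
    simp only [h.eq_of_nhds, h.deriv_eq, deriv_const_sub, deriv_comp_sub_const, map_sub,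
      inner_sub_left, inner_neg_right]
    ring
  have h3 := (innerSL ℝ (symplecticJ n (z 0 + z (1 / 2)))).intervalIntegral_comp_comm
    (hzl.intervalIntegrable_deriv 0 (1 / 2))
  simp only [innerSL_apply_apply] at h3
  rw [h1, h2, intervalIntegral.integral_comp_sub_right (fun t => ⟪symplecticJ n (z t), deriv z t⟫_ℝ
      - ⟪symplecticJ n (z 0 + z (1 / 2)), deriv z t⟫_ℝ), sub_self,
    show (1 : ℝ) - 1 / 2 = 1 / 2 by norm_num, intervalIntegral.integral_sub
      (hzl.intervalIntegrable_inner_deriv hzl.continuous _ _)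
      (hzl.intervalIntegrable_inner_deriv continuous_const _ _), h3, hzl.integral_deriv_eq_sub]
  have h4 := inner_symplecticJ_swap (z (1 / 2)) (z 0)
  simp only [map_add, inner_add_left, inner_sub_right, inner_symplecticJ_self]
  rw [h4]
  ring

/-- The two halves traverse the chord in opposite directions, so the chord terms cancel. -/
theorem loopForm_reflectedHalf_add (hK : IsSmoothStrictlyConvexSymmetricBody K)
    (hz : IsPolarLoop K z) : loopForm (reflectedHalf z) (reflectedHalf z) +
      loopForm (reflectedHalf fun t => z (t + 1 / 2)) (reflectedHalf fun t => z (t + 1 / 2)) =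
        2 * loopForm z z := by
  obtain ⟨C, hC⟩ := hK.exists_gauge_le
  have hzl := hz.lipschitzWith hC
  have hint := hzl.intervalIntegrable_inner_deriv hzl.continuous
  rw [loopForm_reflectedHalf hK hz, loopForm_reflectedHalf hK (hz.comp_add_right (1 / 2)), loopForm,
    ← intervalIntegral.integral_add_adjacent_intervals (hint 0 (1 / 2)) (hint (1 / 2) 1)]
  simp only [deriv_comp_add_const]
  rw [intervalIntegral.integral_comp_add_right fun t => ⟪symplecticJ n (z t), deriv z t⟫_ℝ]
  have h4 := inner_symplecticJ_swap (z (1 / 2)) (z 0)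
  norm_num [hz.one_eq_zero] at h4 ⊢
  rw [h4]
  ring

end ReflectedHalf

namespace IsMaximalPolarLoop

variable {n : ℕ} {K : Set (PhaseSpace n)} {z : ℝ → PhaseSpace n}

/-- Two forms that average to the maximum and do not exceed it both attain it. -/
theorem reflectedHalf (hK : IsSmoothStrictlyConvexSymmetricBody K)
    (hz : IsMaximalPolarLoop K z) : IsMaximalPolarLoop K (reflectedHalf z) where
  toIsPolarLoop := hz.toIsPolarLoop.reflectedHalf hK
  loopForm_le w hw := by
    have h1 := loopForm_reflectedHalf_add hK hz.toIsPolarLoop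
    have h2 := hz.loopForm_le _ ((hz.toIsPolarLoop.comp_add_right (1 / 2)).reflectedHalf hK)
    have h3 := hz.loopForm_le w hw
    linarith

theorem comp_add_right (hz : IsMaximalPolarLoop K z) (s : ℝ) : IsMaximalPolarLoop K fun t => z (t + s) where
  toIsPolarLoop := hz.toIsPolarLoop.comp_add_right s
  loopForm_le w hw := by
    have hper : Function.Periodic (fun t => ⟪symplecticJ n (z t), deriv z t⟫_ℝ) 1 := fun t => by
      have h1 : deriv z (t + 1) = deriv z t := by
        rw [← deriv_comp_add_const]
        exact congrArg (fun f => deriv f t) hz.periodic.funext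
      simp only [hz.periodic t, h1]
    have h1 : loopForm (fun t => z (t + s)) (fun t => z (t + s)) = loopForm z z := by
      simp only [loopForm, deriv_comp_add_const]
      rw [intervalIntegral.integral_comp_add_right fun t => ⟪symplecticJ n (z t), deriv z t⟫_ℝ,
        zero_add, add_comm, hper.intervalIntegral_add_eq s 0, zero_add]
    rw [h1]
    exact hz.loopForm_le w hw

theorem half_eq_neg_zero (hK : IsSmoothStrictlyConvexSymmetricBody K)
    (hz : IsMaximalPolarLoop K z) {r : ℝ} (hr : 0 < r) (hG : ∀ t, gauge K (z t) = r)
    (hd : ∀ t, HasDerivAt z (charField K (z t)) t) : z (1 / 2) = -z 0 := by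
  have hne : ∀ t, z t ≠ 0 := fun t => hK.gauge_pos.1 (hG t ▸ hr)
  have hform : loopForm z z = r := by
    have h1 : ∀ t, ⟪symplecticJ n (z t), deriv z t⟫_ℝ = r := fun t => by
      rw [(hd t).deriv, hK.inner_symplecticJ_charField_self (hne t), hG]
    simp [loopForm, h1]
  have hmax := hz.reflectedHalf hK
  have hform' : loopForm (_root_.reflectedHalf z) (_root_.reflectedHalf z) = r :=
    le_antisymm (hform ▸ hz.loopForm_le _ hmax.toIsPolarLoop)
      (hform ▸ hmax.loopForm_le _ hz.toIsPolarLoop)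
  obtain ⟨c, hc⟩ := hmax.exists_hasDerivAt hK (hform' ▸ hr)
  rw [hform'] at hc
  -- At `1/4` the reflected loop still coincides with `z`, so the velocities at `z - c` and `z`
  -- agree, and both points lie on the level `r`.
  have hc0 : c = 0 := by
    have h1 := reflectedHalf_eventuallyEq_left (z := z) (t := 1 / 4) (by constructor <;> norm_num)
    obtain ⟨h2, h3⟩ := hc (1 / 4)
    rw [h1.eq_of_nhds] at h2 h3
    have h4 := (h3.congr_of_eventuallyEq h1.symm).unique (hd (1 / 4))
    simpa using hK.charField_injective hr h2 (hG _) h4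
  -- At `3/4` the velocity is `-X (z (1/4)) = X (-z (1/4))`, so injectivity identifies the reflected
  -- point with `-z (1/4)`.
  have h1 := reflectedHalf_eventuallyEq_right (z := z) (t := 3 / 4) (by constructor <;> norm_num)
  obtain ⟨h2, h3⟩ := hc (3 / 4)
  have e : (3 / 4 : ℝ) - 1 / 2 = 1 / 4 := by norm_num
  rw [h1.eq_of_nhds, hc0, sub_zero, e] at h2 h3
  have h4 : HasDerivAt (fun s => z 0 + z (1 / 2) - z (s - 1 / 2)) (-charField K (z (1 / 4)))
      (3 / 4) := by
    have h6 : HasDerivAt z (charField K (z (1 / 4))) (3 / 4 - 1 / 2) := by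
      rw [e]; exact hd _
    exact (h6.comp_sub_const (3 / 4) (1 / 2)).const_sub _
  have h5 := (h3.congr_of_eventuallyEq h1.symm).unique h4
  rw [← hK.charField_neg (hne _)] at h5
  have h6 := hK.charField_injective hr h2 (by rw [hK.gauge_neg, hG]) h5
  rw [sub_eq_neg_self] at h6
  exact eq_neg_of_add_eq_zero_right h6

/-- A maximizer that is a characteristic on a dilate of the boundary of `K` is centrally
symmetric. -/
theorem antiperiodic (hK : IsSmoothStrictlyConvexSymmetricBody K)
    (hz : IsMaximalPolarLoop K z) {r : ℝ} (hr : 0 < r) (hG : ∀ t, gauge K (z t) = r)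
    (hd : ∀ t, HasDerivAt z (charField K (z t)) t) : Function.Antiperiodic z (1 / 2) := fun s => by
  have := (hz.comp_add_right s).half_eq_neg_zero hK hr (fun t => hG _)
    fun t => (hd (t + s)).comp_add_const t s
  simpa [add_comm] using this

end IsMaximalPolarLoop

/-! ### Passing between closed characteristics and polar loops. -/

/-- The action of a closed `C¹` curve in terms of the symplectic form. -/
theorem action_eq_integral_symplecticForm {n : ℕ} {T : ℝ} {γ : ℝ → PhaseSpace n} (hT : 0 < T)
    (hγ : ContDiffOn ℝ 1 γ (Icc 0 T)) (hclosed : γ 0 = γ T) :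
    action T γ = (∫ t in (0 : ℝ)..T, ⟪symplecticJ n (γ t), velocity T γ t⟫_ℝ) / 2 := by
  have hv : ContinuousOn (velocity T γ) (Icc 0 T) :=
    hγ.continuousOn_derivWithin (uniqueDiffOn_Icc hT) le_rfl
  have hγi : ∀ i, ContinuousOn (fun t => γ t i) (Icc 0 T) := fun i =>
    (EuclideanSpace.proj (𝕜 := ℝ) i).continuous.comp_continuousOn hγ.continuousOn
  have hvi : ∀ i, ContinuousOn (fun t => velocity T γ t i) (Icc 0 T) := fun i =>
    (EuclideanSpace.proj (𝕜 := ℝ) i).continuous.comp_continuousOn hv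
  have hd : ∀ t ∈ Ioo 0 T, HasDerivAt γ (velocity T γ t) t := fun t ht =>
    ((hγ.differentiableOn one_ne_zero) t (Ioo_subset_Icc_self ht)).hasDerivWithinAt.hasDerivAt
      (Icc_mem_nhds ht.1 ht.2)
  have hdi : ∀ i, ∀ t ∈ Ioo 0 T, HasDerivAt (fun t => γ t i) (velocity T γ t i) t := fun i t ht =>
    (EuclideanSpace.proj (𝕜 := ℝ) i).hasFDerivAt.comp_hasDerivAt t (hd t ht)
  have hDc : ContinuousOn (fun t => ∑ i : Fin n, (velocity T γ t (Sum.inr i) * γ t (Sum.inl i) +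
      γ t (Sum.inr i) * velocity T γ t (Sum.inl i))) (Icc 0 T) :=
    continuousOn_finsetSum _ fun i _ => ((hvi _).mul (hγi _)).add ((hγi _).mul (hvi _))
  have hωc : ContinuousOn (fun t => ⟪symplecticJ n (γ t), velocity T γ t⟫_ℝ) (Icc 0 T) :=
    ((symplecticJ n).continuous.comp_continuousOn hγ.continuousOn).inner hv
  -- The form `2 p dq` differs from `p dq - q dp` by the exact form `d(pq)`, whose integral over the
  -- closed curve vanishes.
  have h1 := intervalIntegral.integral_eq_sub_of_hasDerivAt_of_le hT.le
    (f := fun t => ∑ i : Fin n, γ t (Sum.inr i) * γ t (Sum.inl i))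
    (continuousOn_finsetSum _ fun i _ => (hγi _).mul (hγi _))
    (fun t ht => HasDerivAt.fun_sum fun i _ => (hdi (Sum.inr i) t ht).mul (hdi (Sum.inl i) t ht))
    (hDc.intervalIntegrable_of_Icc hT.le)
  rw [hclosed, sub_self] at h1
  have h2 := intervalIntegral.integral_add (μ := volume) (hωc.intervalIntegrable_of_Icc hT.le)
    (hDc.intervalIntegrable_of_Icc hT.le)
  rw [h1, add_zero] at h2
  rw [← h2, action, ← intervalIntegral.integral_div]
  refine intervalIntegral.integral_congr fun t _ => ?_
  simp only [← symplecticForm_eq_inner, symplecticForm, ← Finset.sum_add_distrib]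
  rw [Finset.sum_div]
  exact Finset.sum_congr rfl fun i _ => by ring

namespace IsClosedCharacteristic

variable {n : ℕ} {K : Set (PhaseSpace n)} {T : ℝ} {γ : ℝ → PhaseSpace n}

theorem gauge_eq_one (hγ : IsClosedCharacteristic K T γ)
    (hK : IsSmoothStrictlyConvexSymmetricBody K) {t : ℝ} (ht : t ∈ Icc 0 T) :
    gauge K (γ t) = 1 :=
  hK.gauge_eq_one_iff.2 (hγ.mem_boundary t ht)

theorem ne_zero (hγ : IsClosedCharacteristic K T γ)
    (hK : IsSmoothStrictlyConvexSymmetricBody K) {t : ℝ} (ht : t ∈ Icc 0 T) : γ t ≠ 0 :=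
  hK.gauge_pos.1 (hγ.gauge_eq_one hK ht ▸ one_pos)

/-- The kernel is a line: by Euler's identity `y - dg(y) • γ t` is tangent for every `y`, and
testing the kernel condition on it determines the velocity. -/
theorem velocity_eq (hγ : IsClosedCharacteristic K T γ)
    (hK : IsSmoothStrictlyConvexSymmetricBody K) {t : ℝ} (ht : t ∈ Icc 0 T) :
    velocity T γ t = ⟪symplecticJ n (γ t), velocity T γ t⟫_ℝ • charField K (γ t) := by
  have hself : fderiv ℝ (gauge K) (γ t) (γ t) = 1 := by
    rw [← inner_symplecticJ_charField, hK.inner_symplecticJ_charField_self (hγ.ne_zero hK ht),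
      hγ.gauge_eq_one hK ht]
  refine eq_of_inner_symplecticJ_eq fun y => ?_
  rw [real_inner_smul_right, inner_symplecticJ_charField]
  have h1 := hγ.velocity_mem_kernel t ht (y - fderiv ℝ (gauge K) (γ t) y • γ t) (by
    rw [boundaryTangentSpace, LinearMap.mem_ker]
    simp [hself])
  rw [symplecticForm_eq_inner, inner_sub_right, real_inner_smul_right,
    inner_symplecticJ_swap _ y, inner_symplecticJ_swap _ (γ t)] at h1
  linarith

/-- Parametrization of a closed characteristic for which the velocity is `± charField K`. -/
theorem exists_reparametrization (hγ : IsClosedCharacteristic K T γ)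
    (hK : IsSmoothStrictlyConvexSymmetricBody K) :
    ∃ (L e : ℝ) (η : ℝ ≃o ℝ), 0 < L ∧ (e = 1 ∨ e = -1) ∧ η 0 = 0 ∧ η L = T ∧
      |action T γ| = L / 2 ∧
      ∀ u ∈ Ioo 0 L, HasDerivAt (fun u => γ (η u)) (e • charField K (γ (η u))) u := by
  have hT := hγ.pos
  have hv : ContinuousOn (velocity T γ) (Icc 0 T) :=
    hγ.contDiffOn.continuousOn_derivWithin (uniqueDiffOn_Icc hT) le_rfl
  set c : ℝ → ℝ := fun t => ⟪symplecticJ n (γ t), velocity T γ t⟫_ℝ with hc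
  have hcc : ContinuousOn c (Icc 0 T) :=
    ((symplecticJ n).continuous.comp_continuousOn hγ.contDiffOn.continuousOn).inner hv
  have hc0 : ∀ t ∈ Icc 0 T, c t ≠ 0 := fun t ht h0 => by
    have h1 := hγ.velocity_eq hK ht
    rw [show ⟪symplecticJ n (γ t), velocity T γ t⟫_ℝ = 0 from h0, zero_smul] at h1
    exact hγ.velocity_ne_zero t ht h1
  -- The speed factor never vanishes, so it keeps one sign on the interval; `e` records the
  -- direction of travel.
  obtain ⟨e, he, hec⟩ : ∃ e : ℝ, (e = 1 ∨ e = -1) ∧ ∀ t ∈ Icc 0 T, 0 < e * c t := by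
    have h0 : (0 : ℝ) ∈ Icc 0 T := ⟨le_rfl, hT.le⟩
    have hpre := isPreconnected_Icc.image c hcc
    have hnot : (0 : ℝ) ∉ c '' Icc 0 T := fun ⟨t, ht, h⟩ => hc0 t ht h
    rcases lt_or_gt_of_ne (hc0 0 h0) with h | h
    · refine ⟨-1, Or.inr rfl, fun t ht => ?_⟩
      by_contra! hle
      exact hnot (hpre.ordConnected.out (mem_image_of_mem c h0) (mem_image_of_mem c ht)
        ⟨h.le, by linarith⟩)
    · refine ⟨1, Or.inl rfl, fun t ht => ?_⟩
      by_contra! hle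
      exact hnot (hpre.ordConnected.out (mem_image_of_mem c ht) (mem_image_of_mem c h0)
        ⟨by linarith, h.le⟩)
  have hee : e * e = 1 := by rcases he with rfl | rfl <;> norm_num
  -- The constant extension beyond `[0, T]` keeps the speed bounded below, so its primitive `θ` is
  -- an order isomorphism of the whole line.
  set m : ℝ → ℝ := IccExtend hT.le ((Icc 0 T).domRestrict fun t => e * c t) with hm
  have hmcont : Continuous m :=
    (continuousOn_iff_continuous_domRestrict.1 (continuousOn_const.mul hcc)).Icc_extend'
  have hmeq : ∀ t ∈ Icc 0 T, m t = e * c t := fun t ht => by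
    rw [hm, IccExtend_of_mem _ _ ht, domRestrict_apply]
  obtain ⟨t₀, ht₀, hmin⟩ := isCompact_Icc.exists_isMinOn (nonempty_Icc.2 hT.le)
    (continuousOn_const.mul hcc : ContinuousOn (fun t => e * c t) (Icc 0 T))
  set a := e * c t₀ with ha
  have hapos : 0 < a := hec t₀ ht₀
  have ham : ∀ t, a ≤ m t := fun t => hmin (projIcc 0 T hT.le t).2
  have hmpos : ∀ t, 0 < m t := fun t => hapos.trans_le (ham t)
  set θ : ℝ → ℝ := fun s => ∫ t in (0 : ℝ)..s, m t with hθ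
  have hθd : ∀ s, HasDerivAt θ (m s) s := fun s => (hmcont.integral_hasStrictDerivAt 0 s).hasDerivAt
  have hθmono : StrictMono θ := strictMono_of_deriv_pos fun s => by
    rw [(hθd s).deriv]; exact hmpos s
  have hθ0 : θ 0 = 0 := intervalIntegral.integral_same
  have hgrow : ∀ s t, s ≤ t → a * (t - s) ≤ θ t - θ s := fun s t hst =>
    mul_sub_le_image_sub_of_le_deriv (fun s => (hθd s).differentiableAt)
      (fun s => by rw [(hθd s).deriv]; exact ham s) hst
  have hθcont : Continuous θ := continuous_iff_continuousAt.2 fun s => (hθd s).continuousAt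
  have hsurj : Function.Surjective θ := by
    refine hθcont.surjective ?_ ?_
    · refine tendsto_atTop_mono' _ ?_ (tendsto_id.const_mul_atTop hapos)
      filter_upwards [eventually_ge_atTop 0] with s hs
      have := hgrow 0 s hs
      rw [hθ0] at this
      simpa using this
    · refine tendsto_atBot_mono' _ ?_ (tendsto_id.const_mul_atBot hapos)
      filter_upwards [eventually_le_atBot 0] with s hs
      have := hgrow s 0 hs
      rw [hθ0] at this
      simp only [id]
      linarith
  set θi := hθmono.orderIsoOfSurjective θ hsurj with hθi
  have hθη : ∀ u, θ (θi.symm u) = u := fun u => θi.apply_symm_apply u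
  have hηθ : ∀ s, θi.symm (θ s) = s := fun s => θi.symm_apply_apply s
  have hη0 : θi.symm 0 = 0 := by
    have := hηθ 0
    rwa [hθ0] at this
  have hL : 0 < θ T := by rw [← hθ0]; exact hθmono hT
  refine ⟨θ T, e, θi.symm, hL, he, hη0, hηθ T, ?_, fun u hu => ?_⟩
  · have h1 : θ T = e * ∫ t in (0 : ℝ)..T, c t := by
      rw [hθ, ← intervalIntegral.integral_const_mul]
      refine intervalIntegral.integral_congr fun t ht => hmeq t ?_
      rwa [uIcc_of_le hT.le] at ht
    have h2 : (∫ t in (0 : ℝ)..T, c t) = e * θ T := by rw [h1, ← mul_assoc, hee, one_mul]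
    rw [action_eq_integral_symplecticForm hT hγ.contDiffOn hγ.closed, h2, abs_div, abs_mul,
      abs_of_pos hL]
    rcases he with rfl | rfl <;> simp
  · have hmem : θi.symm u ∈ Ioo 0 T := by
      constructor
      · rw [← hη0]; exact θi.symm.strictMono hu.1
      · rw [← hηθ T]; exact θi.symm.strictMono hu.2
    have hmem' := Ioo_subset_Icc_self hmem
    have hηd : HasDerivAt θi.symm (m (θi.symm u))⁻¹ u :=
      HasDerivAt.of_local_left_inverse θi.symm.continuous.continuousAt (hθd _) (hmpos _).ne'
        (Eventually.of_forall hθη)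
    have hγd : HasDerivAt γ (velocity T γ (θi.symm u)) (θi.symm u) :=
      ((hγ.contDiffOn.differentiableOn one_ne_zero) _ hmem').hasDerivWithinAt.hasDerivAt
        (Icc_mem_nhds hmem.1 hmem.2)
    have h1 := hγd.scomp u hηd
    rw [hγ.velocity_eq hK hmem', hmeq _ hmem', smul_smul] at h1
    have h2 : (e * c (θi.symm u))⁻¹ * c (θi.symm u) = e := by
      have := hc0 _ hmem'
      rw [mul_inv, mul_assoc, inv_mul_cancel₀ this, mul_one]
      exact inv_eq_of_mul_eq_one_left hee
    rw [← h2]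
    exact h1

end IsClosedCharacteristic

/-- Up to translation and dilation, a maximizer is a closed characteristic. -/
theorem IsMaximalPolarLoop.exists_isClosedCharacteristic {n : ℕ} {K : Set (PhaseSpace n)}
    {z : ℝ → PhaseSpace n} (hK : IsSmoothStrictlyConvexSymmetricBody K)
    (hz : IsMaximalPolarLoop K z) (hM : 0 < loopForm z z) :
    ∃ γ, IsClosedCharacteristic K 1 γ ∧ |action 1 γ| = (loopForm z z)⁻¹ / 2 := by
  obtain ⟨c, hc⟩ := hz.exists_hasDerivAt hK hM
  set M := loopForm z z
  have hMi : 0 < M⁻¹ := inv_pos.2 hM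
  -- This scaling lands on `∂K`; as `charField K` is homogeneous of degree zero, the velocity
  -- becomes `M⁻¹` times the field.
  set γ : ℝ → PhaseSpace n := fun t => M⁻¹ • (z t - c) with hγ
  have hne : ∀ t, z t - c ≠ 0 := fun t => hK.gauge_pos.1 ((hc t).1 ▸ hM)
  have hG : ∀ t, gauge K (γ t) = 1 := fun t => by
    rw [hγ, IsSmoothStrictlyConvexSymmetricBody.gauge_smul _ hMi.le, (hc t).1,
      inv_mul_cancel₀ hM.ne']
  have hγ0 : ∀ t, γ t ≠ 0 := fun t => hK.gauge_pos.1 (hG t ▸ one_pos)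
  have hd : ∀ t, HasDerivAt γ (M⁻¹ • charField K (γ t)) t := fun t => by
    rw [hγ, hK.charField_smul (hne t) hMi]
    exact ((hc t).2.sub_const c).const_smul M⁻¹
  have hγc : Continuous γ := continuous_iff_continuousAt.2 fun t => (hd t).continuousAt
  have hcd : ContDiff ℝ 1 γ := by
    refine contDiff_one_iff_deriv.2 ⟨fun t => (hd t).differentiableAt, ?_⟩
    rw [show deriv γ = fun t => M⁻¹ • charField K (γ t) from funext fun t => (hd t).deriv]
    exact (hK.continuousOn_charField.comp_continuous hγc hγ0).const_smul M⁻¹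
  have hv : ∀ t ∈ Icc (0 : ℝ) 1, velocity 1 γ t = M⁻¹ • charField K (γ t) := fun t ht =>
    (hd t).hasDerivWithinAt.derivWithin (uniqueDiffOn_Icc one_pos t ht)
  have hω : ∀ t, ⟪symplecticJ n (γ t), M⁻¹ • charField K (γ t)⟫_ℝ = M⁻¹ := fun t => by
    rw [real_inner_smul_right, hK.inner_symplecticJ_charField_self (hγ0 t), hG, mul_one]
  have hclosed : γ 0 = γ 1 := by rw [hγ]; simp only [hz.one_eq_zero]
  refine ⟨γ, ⟨one_pos, hcd.contDiffOn, hclosed, fun t _ => hK.gauge_eq_one_iff.1 (hG t),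
    fun t ht => ?_, fun t ht => ?_, fun t ht v hvt => ?_⟩, ?_⟩
  · intro h0
    have h1 := hω t
    rw [← hv t ht, h0, inner_zero_right] at h1
    exact hMi.ne h1
  · rw [hv t ht]
    refine Submodule.smul_mem _ _ ?_
    rw [boundaryTangentSpace, LinearMap.mem_ker]
    change fderiv ℝ (gauge K) (γ t) _ = 0
    rw [← inner_symplecticJ_charField, inner_symplecticJ_self]
  · rw [symplecticForm_eq_inner, hv t ht, inner_symplecticJ_swap, real_inner_smul_right,
      inner_symplecticJ_charField]
    have h1 : fderiv ℝ (gauge K) (γ t) v = 0 := hvt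
    rw [h1, mul_zero, neg_zero]
  · rw [action_eq_integral_symplecticForm one_pos hcd.contDiffOn hclosed,
      intervalIntegral.integral_congr (g := fun _ => M⁻¹) fun t ht => by
        rw [uIcc_of_le zero_le_one] at ht
        simp only [hv t ht, hω t]]
    simp [abs_of_pos (half_pos hMi)]

/-- A closed characteristic, suitably parametrized and scaled, has velocity `charField K`. -/
theorem IsClosedCharacteristic.exists_isPolarLoop {n : ℕ} {K : Set (PhaseSpace n)} {T : ℝ}
    {γ : ℝ → PhaseSpace n} (hγ : IsClosedCharacteristic K T γ)
    (hK : IsSmoothStrictlyConvexSymmetricBody K) {L e : ℝ} {η : ℝ ≃o ℝ} (hL : 0 < L)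
    (he : e = 1 ∨ e = -1) (hη0 : η 0 = 0) (hηL : η L = T)
    (hd : ∀ u ∈ Ioo 0 L, HasDerivAt (fun u => γ (η u)) (e • charField K (γ (η u))) u) :
    ∃ z, IsPolarLoop K z ∧ loopForm z z = L⁻¹ ∧
      (∀ t ∈ Icc (0 : ℝ) 1, z t = L⁻¹ • γ (η (L * ((1 - e) / 2 + e * t)))) ∧
      ∀ t ∈ Ioo (0 : ℝ) 1, gauge K (z t) = L⁻¹ ∧ HasDerivAt z (charField K (z t)) t := by
  have hLi : 0 < L⁻¹ := inv_pos.2 hL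
  have hee : e * e = 1 := by rcases he with rfl | rfl <;> norm_num
  -- This is `L * t` for `e = 1` and `L * (1 - t)` for `e = -1`, so a curve running against the
  -- field is reversed.
  set ℓ : ℝ → ℝ := fun t => L * ((1 - e) / 2 + e * t) with hℓ
  have hℓmem : ∀ t ∈ Icc (0 : ℝ) 1, ℓ t ∈ Icc 0 L := fun t ht => by
    rcases he with rfl | rfl <;> constructor <;> simp only [hℓ] <;> nlinarith [ht.1, ht.2]
  have hℓmem' : ∀ t ∈ Ioo (0 : ℝ) 1, ℓ t ∈ Ioo 0 L := fun t ht => by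
    rcases he with rfl | rfl <;> constructor <;> simp only [hℓ] <;> nlinarith [ht.1, ht.2]
  have hηmem : ∀ u ∈ Icc 0 L, η u ∈ Icc 0 T := fun u hu =>
    ⟨hη0 ▸ η.monotone hu.1, hηL ▸ η.monotone hu.2⟩
  have hmem : ∀ t ∈ Icc (0 : ℝ) 1, η (ℓ t) ∈ Icc 0 T := fun t ht => hηmem _ (hℓmem t ht)
  set f : ℝ → PhaseSpace n := fun t => L⁻¹ • γ (η (ℓ t)) with hf
  have hf01 : f 0 = f 1 := by
    have h0 : γ (η 0) = γ (η L) := by rw [hη0, hηL, hγ.closed]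
    rcases he with rfl | rfl
    · simp [hf, hℓ, h0]
    · norm_num [hf, hℓ, h0]
  have hG : ∀ t ∈ Icc (0 : ℝ) 1, gauge K (f t) = L⁻¹ := fun t ht => by
    rw [hf, IsSmoothStrictlyConvexSymmetricBody.gauge_smul _ hLi.le,
      hγ.gauge_eq_one hK (hmem t ht), mul_one]
  have hf0 : ∀ t ∈ Icc (0 : ℝ) 1, f t ≠ 0 := fun t ht => hK.gauge_pos.1 (hG t ht ▸ hLi)
  have hfd : ∀ t ∈ Ioo (0 : ℝ) 1, HasDerivAt f (charField K (f t)) t := fun t ht => by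
    have ht' := Ioo_subset_Icc_self ht
    have h1 : HasDerivAt ℓ (L * e) t := by
      simpa using (((hasDerivAt_id t).const_mul e).const_add ((1 - e) / 2)).const_mul L
    have h2 := ((hd _ (hℓmem' t ht)).scomp t h1).const_smul L⁻¹
    rw [smul_smul, smul_smul, show L⁻¹ * (L * e) * e = 1 by rw [mul_assoc, mul_assoc, hee]; field_simp,
      one_smul] at h2
    rw [hf, hK.charField_smul (hγ.ne_zero hK (hmem t ht')) hLi]
    exact h2
  have hfc : ContinuousOn f (Icc 0 1) :=
    (hγ.contDiffOn.continuousOn.comp (f := fun t => η (ℓ t))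
      (η.continuous.comp (by fun_prop : Continuous ℓ)).continuousOn hmem).const_smul L⁻¹
  have hpol : ∀ s t, 0 ≤ s → s ≤ t → t ≤ 1 → SymplecticPolar K (t - s) (f t - f s) :=
    fun s t hs hst ht y => by
      have hdy : ∀ τ ∈ Ioo (0 : ℝ) 1, HasDerivAt (fun t => ⟪symplecticJ n y, f t⟫_ℝ)
          ⟪symplecticJ n y, charField K (f τ)⟫_ℝ τ := fun τ hτ => by
        simpa using (hasDerivAt_const τ (symplecticJ n y)).inner ℝ (hfd τ hτ)
      have h1 := (convex_Icc (0 : ℝ) 1).image_sub_le_mul_sub_of_deriv_le (C := gauge K y)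
        (f := fun t => ⟪symplecticJ n y, f t⟫_ℝ) (continuousOn_const.inner hfc)
        (fun τ hτ => by
          rw [interior_Icc] at hτ
          exact (hdy τ hτ).differentiableAt.differentiableWithinAt)
        (fun τ hτ => by
          rw [interior_Icc] at hτ
          rw [(hdy τ hτ).deriv, ← one_mul (gauge K y)]
          exact hK.symplecticPolar_charField (hf0 τ (Ioo_subset_Icc_self hτ)) y)
        s ⟨hs, hst.trans ht⟩ t ⟨hs.trans hst, ht⟩ hst
      rw [inner_sub_right, mul_comm]
      exact h1
  set z : ℝ → PhaseSpace n := fun t => f (Int.fract t) with hz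
  have hzf : ∀ t ∈ Icc (0 : ℝ) 1, z t = f t := fun t ht => by
    rcases ht.2.eq_or_lt with rfl | h
    · rw [hz, ← hf01]; simp
    · rw [hz]; simp only [Int.fract_eq_self.2 ⟨ht.1, h⟩]
  have hzd : ∀ t ∈ Ioo (0 : ℝ) 1, gauge K (z t) = L⁻¹ ∧ HasDerivAt z (charField K (z t)) t :=
    fun t ht => by
      have ht' := Ioo_subset_Icc_self ht
      rw [hzf t ht']
      refine ⟨hG t ht', (hfd t ht).congr_of_eventuallyEq ?_⟩
      filter_upwards [Ioo_mem_nhds ht.1 ht.2] with s hs using hzf s (Ioo_subset_Icc_self hs)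
  refine ⟨z, isPolarLoop_comp_fract hpol hf01, ?_, hzf, hzd⟩
  rw [loopForm, intervalIntegral.integral_congr_Ioo_of_le (g := fun _ => L⁻¹) zero_le_one
    fun t ht => by
      obtain ⟨h1, h2⟩ := hzd t ht
      simp only [h2.deriv]
      rw [hK.inner_symplecticJ_charField_self (hK.gauge_pos.1 (h1 ▸ hLi)), h1]]
  simp

/-! ### Minimal characteristics are maximizers, and the conclusion. -/

/-- A closed characteristic of minimal action maximizes the action among the closed curves of the
same length. -/
theorem IsMinimalClosedCharacteristic.isMaximalPolarLoop {n : ℕ} {K : Set (PhaseSpace n)} {T : ℝ}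
    {γ z : ℝ → PhaseSpace n} (hγ : IsMinimalClosedCharacteristic K T γ)
    (hK : IsSmoothStrictlyConvexSymmetricBody K) {L : ℝ} (hL : 0 < L)
    (haction : |action T γ| = L / 2) (hz : IsPolarLoop K z) (hform : loopForm z z = L⁻¹) :
    IsMaximalPolarLoop K z := by
  obtain ⟨w, hw, hmax⟩ := exists_isPolarLoop_forall_loopForm_le hK
  -- Positivity of the maximum comes from the given characteristic itself.
  have hM : 0 < loopForm w w := (hform ▸ inv_pos.2 hL).trans_le (hmax z hz)
  obtain ⟨γ', hγ', ha⟩ := IsMaximalPolarLoop.exists_isClosedCharacteristic hK ⟨hw, hmax⟩ hM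
  have h1 := hγ.2 1 γ' hγ'
  rw [haction, ha] at h1
  have h2 : loopForm w w ≤ L⁻¹ := by
    rw [← inv_inv (loopForm w w)]
    exact inv_anti₀ hL (by linarith)
  exact ⟨hz, fun y hy => (hmax y hy).trans (hform ▸ h2)⟩

theorem corollary3 (n : ℕ) (K : Set (PhaseSpace n))
    (hK : IsSmoothStrictlyConvexSymmetricBody K) (T : ℝ) (γ : ℝ → PhaseSpace n)
    (hγ : IsMinimalClosedCharacteristic K T γ) :
    (fun x => -x) '' (γ '' Set.Icc 0 T) = γ '' Set.Icc 0 T ∧ IsCentrallySymmetricLoop T γ := by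
  have hγc := hγ.1
  obtain ⟨L, e, η, hL, he, hη0, hηL, haction, hd⟩ := hγc.exists_reparametrization hK
  have hLi : 0 < L⁻¹ := inv_pos.2 hL
  obtain ⟨z, hz, hform, hzγ, hzd⟩ := hγc.exists_isPolarLoop hK hL he hη0 hηL hd
  have hmax := hγ.isMaximalPolarLoop hK hL haction hz hform
  have hanti : Function.Antiperiodic z (1 / 2) := by
    obtain ⟨c, hc⟩ := hmax.exists_hasDerivAt hK (hform ▸ hLi)
    rw [hform] at hc
    -- The loop already satisfies the equation centred at the origin; injectivity of the field on
    -- the level `L⁻¹` identifies the two centres.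
    have hc0 : c = 0 := by
      obtain ⟨h1, h2⟩ := hzd (1 / 2) (by constructor <;> norm_num)
      obtain ⟨h3, h4⟩ := hc (1 / 2)
      simpa using hK.charField_injective hLi h3 h1 (h4.unique h2)
    simp only [hc0, sub_zero] at hc
    exact hmax.antiperiodic hK hLi (fun t => (hc t).1) fun t => (hc t).2
  have hhalf : ∀ v ∈ Icc 0 (L / 2), γ (η (v + L / 2)) = -γ (η v) := fun v hv => by
    have hv0 : 0 ≤ v / L := div_nonneg hv.1 hL.le
    have hv1 : v / L ≤ 1 / 2 := by rw [div_le_iff₀ hL]; linarith [hv.2]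
    have hinj : ∀ x y : PhaseSpace n, L⁻¹ • x = -(L⁻¹ • y) → x = -y := fun x y h => by
      rw [← smul_neg] at h
      exact smul_right_injective _ hLi.ne' h
    rcases he with rfl | rfl
    · have h1 := hanti (v / L)
      rw [hzγ _ ⟨by linarith, by linarith⟩, hzγ _ ⟨by linarith, by linarith⟩] at h1
      have e1 : L * ((1 - 1) / 2 + 1 * (v / L + 1 / 2)) = v + L / 2 := by field_simp; ring
      have e2 : L * ((1 - 1) / 2 + 1 * (v / L)) = v := by field_simp; ring
      rw [e1, e2] at h1
      exact hinj _ _ h1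
    -- Time is reversed here, so the parameters `v + L / 2` and `v` correspond to `1 / 2 - v / L`
    -- and `1 - v / L`.
    · have h1 := hanti (1 / 2 - v / L)
      rw [hzγ _ ⟨by linarith, by linarith⟩, hzγ _ ⟨by linarith, by linarith⟩] at h1
      have e1 : L * ((1 - -1) / 2 + -1 * (1 / 2 - v / L + 1 / 2)) = v := by field_simp; ring
      have e2 : L * ((1 - -1) / 2 + -1 * (1 / 2 - v / L)) = v + L / 2 := by field_simp; ring
      rw [e1, e2] at h1
      exact (neg_eq_iff_eq_neg.2 (hinj _ _ h1)).symm
  -- The half-period shift, conjugated back to the original parameter of `γ`.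
  set φ : ℝ ≃o ℝ := (η.symm.trans (OrderIso.addRight (L / 2))).trans η with hφ
  have hφη : ∀ t, φ t = η (η.symm t + L / 2) := fun t => rfl
  set τ := η (L / 2) with hτ
  have hτ0 : 0 < τ := by rw [← hη0]; exact η.strictMono (by linarith)
  have hτT : τ < T := by rw [← hηL]; exact η.strictMono (by linarith)
  have hφ0 : φ 0 = τ := by rw [hφη, η.symm_apply_eq.2 hη0.symm, zero_add]
  have hφτ : φ τ = T := by rw [hφη, hτ, η.symm_apply_apply, add_halves, hηL]
  have himage : φ '' Icc 0 τ = Icc τ T := by rw [φ.image_Icc, hφ0, hφτ]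
  have hφγ : ∀ t ∈ Icc 0 τ, γ (φ t) = -γ t := fun t ht => by
    have hmem : η.symm t ∈ Icc 0 (L / 2) := by
      constructor
      · rw [η.le_symm_apply, hη0]; exact ht.1
      · rw [η.symm_apply_le]; exact ht.2
    rw [hφη, hhalf _ hmem, η.apply_symm_apply]
  have hneg : ∀ t ∈ Icc 0 T, ∃ s ∈ Icc 0 T, γ s = -γ t := fun t ht => by
    rcases le_total t τ with h | h
    · have h1 : φ t ∈ Icc τ T := himage ▸ mem_image_of_mem φ ⟨ht.1, h⟩
      exact ⟨φ t, ⟨hτ0.le.trans h1.1, h1.2⟩, hφγ t ⟨ht.1, h⟩⟩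
    · obtain ⟨s, hs, rfl⟩ : t ∈ φ '' Icc 0 τ := himage ▸ ⟨h, ht.2⟩
      exact ⟨s, ⟨hs.1, hs.2.trans hτT.le⟩, by rw [hφγ s hs, neg_neg]⟩
  refine ⟨Subset.antisymm ?_ ?_, τ, ⟨hτ0, hτT⟩, φ, φ.strictMono.strictMonoOn _, himage, hφγ⟩
  · rintro _ ⟨_, ⟨t, ht, rfl⟩, rfl⟩
    exact hneg t ht
  · rintro _ ⟨t, ht, rfl⟩
    obtain ⟨s, hs, h⟩ := hneg t ht
    exact ⟨γ s, mem_image_of_mem γ hs, by simp [h]⟩
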